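/- Let $n\ge 3$, and let $\Gamma_n=\langle b_1,\dots,b_n \mid b_1^2=\cdots=b_n^2=1\rangle$ act on $\mathbb{C}^n$ by $$b_i(x_1,\dots,x_n)=\Big(x_1,\dots,x_{i-1},\ \prod_{j\ne i}x_j-x_i,\ x_{i+1},\dots,x_n\Big).$$ Let $\Delta$ be the Cayley graph of $\Gamma_n$: its vertices are the elements of $\Gamma_n$, and $g,h$ are joined by an edge labelled $i$ if and only if $g=hb_i$. For a two-element set $\{i,j\}\subset\{1,\dots,n\}$, an alternating geodesic with labels $\{i,j\}$ is a connected component of the graph obtained from $\Delta$ by removing all edges whose label is not in $\{i,j\}$; let $\mathcal{A}$ be the set of all alternating geodesics, for all pairs $\{i,j\}$. Every $\mathbf{a}\in\mathbb{C}^n$ induces a map $\phi_{\mathbf{a}}:\mathcal{A}\to\mathbb{C}$: if $\gamma$ has labels $\{i,j\}$, $g$ is any vertex of $\gamma$, and $g^{-1}(\mathbf{a})=(x_1,\dots,x_n)$, then $\phi_{\mathbf{a}}(\gamma)=\prod_{k\ne i,j}x_k$ (this does not depend on the choice of $g$). Let $\mathcal{D}$ be the set of all $\mathbf{a}\in\mathbb{C}^n$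 such that (i) $\phi_{\mathbf{a}}(\gamma)\notin[-2,2]$ for all $\gamma\in\mathcal{A}$; and (ii) for some real $K>2$, the set $\{\gamma\in\mathcal{A} : |\phi_{\mathbf{a}}(\gamma)|\le K\}$ is finite. Then $\mathcal{D}$ is a non-empty open subset of $\mathbb{C}^n$, it is invariant under $\Gamma_n$ (that is, $g\mathcal{D}=\mathcal{D}$ for all $g\in\Gamma_n$), and $\Gamma_n$ acts properly discontinuously on $\mathcal{D}$: for every compact set $C\subset\mathcal{D}$, the set $\{g\in\Gamma_n : gC\cap C\neq\emptyset\}$ is finite. Furthermore, $\mathbf{0}\in\mathbb{C}^n$ does not lie in the closure of $\mathcal{D}$. -/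

import Mathlib

namespace MarkoffHurwitz

/-- The set of relators `b_i ^ 2`, `i = 1, …, n`. -/
def relators (n : ℕ) : Set (FreeGroup (Fin n)) :=
  Set.range fun i => FreeGroup.of i ^ 2

/-- The group `Γ_n = ⟨ b_1, …, b_n ∣ b_1 ^ 2 = ⋯ = b_n ^ 2 = 1 ⟩`. -/
abbrev Gam (n : ℕ) : Type := PresentedGroup (relators n)

/-- The generator `b_i` of `Γ_n`. -/
def gen {n : ℕ} (i : Fin n) : Gam n := PresentedGroup.of i

theorem gen_mul_self {n : ℕ} (i : Fin n) : gen i * gen i = 1 := by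
  have h : PresentedGroup.mk (relators n) (FreeGroup.of i ^ 2) = 1 :=
    PresentedGroup.one_of_mem ⟨i, rfl⟩
  simpa [pow_two, gen, PresentedGroup.of] using h

/-- The map `b_i` of `ℂⁿ`: it fixes the coordinates `x_j`, `j ≠ i`, and replaces `x_i` by
`∏_{j ≠ i} x_j - x_i`. -/
def flipMap {n : ℕ} (i : Fin n) (x : Fin n → ℂ) : Fin n → ℂ :=
  Function.update x i (∏ j ∈ Finset.univ.erase i, x j - x i)

theorem flipMap_involutive {n : ℕ} (i : Fin n) : Function.Involutive (flipMap i) := by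
  intro x
  have h : ∏ j ∈ Finset.univ.erase i, flipMap i x j = ∏ j ∈ Finset.univ.erase i, x j :=
    Finset.prod_congr rfl fun j hj => by simp [flipMap, Finset.ne_of_mem_erase hj]
  funext k
  by_cases hk : k = i
  · subst hk
    rw [flipMap, Function.update_self, h]
    simp [flipMap]
  · simp [flipMap, hk]

/-- The homomorphism from `Γ_n` to the bijections of `ℂⁿ` which sends each generator `b_i` to
the map `b_i`. -/
def actionHom (n : ℕ) : Gam n →* Equiv.Perm (Fin n → ℂ) :=
  PresentedGroup.toGroup (f := fun i => (flipMap_involutive i).toPerm (flipMap i)) (by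
    rintro _ ⟨i, rfl⟩
    ext1 x
    simpa [pow_two] using flipMap_involutive i x)

/-- The action of `Γ_n` on `ℂⁿ`. -/
instance instMulActionGam (n : ℕ) : MulAction (Gam n) (Fin n → ℂ) :=
  MulAction.compHom (Fin n → ℂ) (actionHom n)

theorem gen_smul {n : ℕ} (i : Fin n) (x : Fin n → ℂ) : gen i • x = flipMap i x := by
  change actionHom n (gen i) x = _
  simp [actionHom, gen]

/-- The spanning subgraph of the Cayley graph `Δ` of `Γ_n` which consists of the edges with a
label in `I`; `g` and `h` are joined by an edge with label `i` if and only if `g = h * b_i`.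
The Cayley graph `Δ` itself is the case where `I` is the set of all labels. -/
def labelGraph {n : ℕ} (I : Finset (Fin n)) : SimpleGraph (Gam n) where
  Adj g h := g ≠ h ∧ ∃ i ∈ I, g = h * gen i
  symm := ⟨by
    rintro g h ⟨hne, i, hi, rfl⟩
    exact ⟨hne.symm, i, hi, by rw [mul_assoc, gen_mul_self, mul_one]⟩⟩
  loopless := ⟨fun _ h => h.1 rfl⟩

/-- The set `𝒜` of alternating geodesics. An alternating geodesic with labels in the two-element
set `I = {i, j}` is a connected component of what remains of the tree `Δ` when all the edges with
a label outside `I` are removed, and `𝒜` is the disjoint union over all the sets `I`. -/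
abbrev AltGeodesic (n : ℕ) : Type :=
  Σ I : {I : Finset (Fin n) // I.card = 2}, (labelGraph I.1).ConnectedComponent

/-- The vector-valued Hurwitz map `Φ_a : V(Δ) → ℂⁿ`, `Φ_a(g) = g⁻¹(a)`. -/
def vecHurwitz {n : ℕ} (a : Fin n → ℂ) (g : Gam n) : Fin n → ℂ := g⁻¹ • a

/-- Along an edge with label in `I`, the coordinates of `Φ_a` outside `I` do not change. -/
theorem vecHurwitz_eq_of_adj {n : ℕ} (a : Fin n → ℂ) {I : Finset (Fin n)} {g h : Gam n}
    (hgh : (labelGraph I).Adj g h) {k : Fin n} (hk : k ∉ I) :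
    vecHurwitz a g k = vecHurwitz a h k := by
  obtain ⟨-, i, hi, rfl⟩ := hgh
  have hinv : (gen i : Gam n)⁻¹ = gen i := inv_eq_of_mul_eq_one_left (gen_mul_self i)
  have hki : k ≠ i := fun e => hk (e ▸ hi)
  simp [vecHurwitz, mul_smul, hinv, gen_smul, flipMap, hki]

/-- The extended Hurwitz map `φ_a : 𝒜 → ℂ`: for an alternating geodesic `γ` with set of labels
`I = {i, j}` and any vertex `g` of `γ`, with `Φ_a(g) = (x_1, …, x_n)`, its value is
`φ_a(γ) = ∏_{k ≠ i, j} x_k`. -/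
def extHurwitz {n : ℕ} (a : Fin n → ℂ) (γ : AltGeodesic n) : ℂ :=
  γ.2.lift (fun g => ∏ k ∈ γ.1.1ᶜ, vecHurwitz a g k) (by
    intro v w p hp
    clear hp
    induction p with
    | nil => rfl
    | cons hadj _ ih =>
      exact (Finset.prod_congr rfl fun k hk =>
        vecHurwitz_eq_of_adj a hadj (Finset.mem_compl.mp hk)).trans ih)

theorem extHurwitz_mk {n : ℕ} (a : Fin n → ℂ) (I : {I : Finset (Fin n) // I.card = 2})
    (g : Gam n) :
    extHurwitz a ⟨I, (labelGraph I.1).connectedComponentMk g⟩ =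
      ∏ k ∈ I.1ᶜ, vecHurwitz a g k := rfl

/-- The set `𝒟 ⊆ ℂⁿ` of all `a` for which `φ_a` satisfies the Bowditch conditions:
(i) `φ_a(γ)` is not in the real interval `[-2, 2]` for any `γ`;
(ii) for some `K > 2` there are only finitely many `γ` with `|φ_a(γ)| ≤ K`. -/
def bowditchDomain (n : ℕ) : Set (Fin n → ℂ) :=
  {a | (∀ γ : AltGeodesic n, extHurwitz a γ ∉ Complex.ofReal '' Set.Icc (-2 : ℝ) 2) ∧
    ∃ K : ℝ, 2 < K ∧ {γ : AltGeodesic n | ‖extHurwitz a γ‖ ≤ K}.Finite}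

end MarkoffHurwitz

/-!
Vertices of the Cayley graph are reduced words, and a geodesic is determined by its root and its
labels. Let `a ∈ 𝒟`. Sufficiently far from `1`, an outward step multiplies the coordinates by a
definite factor: either the product of the other coordinates dominates the flipped coordinate, or
one travels along one of the finitely many small geodesics. There the two moving coordinates satisfy
`y (m + 2) = (l + l⁻¹) * y (m + 1) - y m` with `1 < ‖l‖`, and they grow, since a decaying solution
would make infinitely many of the adjacent geodesics small. Such an expansion follows from an open
condition on finitely many points of the orbit, so it persists on a neighbourhood of `a`: hence `𝒟`
is open and the action on it is properly discontinuous.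

The products of `n ≥ 3` coordinates are of third order at the origin, so near it the invariant
polynomial `∑ x i ^ 2 - ∏ x i` forces the squares of the coordinates nearly to cancel. Moving along
the geodesic of two coordinates which cancel partially then lowers the Euclidean norm, so that
arbitrarily long words lead to points of a small ball. This contradicts the expansion, so `𝒟` stays
away from `0`.
-/

namespace MarkoffHurwitz

/-! ### Reduced words -/

section Words

variable {α : Type*}

/-- A reduced word of the free product of copies of `ℤ/2` indexed by `α`: no two consecutive
letters are equal. -/
abbrev Reduced (l : List α) : Prop := l.IsChain (· ≠ ·)

theorem Reduced.dropWhile {l : List α} (h : Reduced l) (p : α → Bool) : Reduced (l.dropWhile p) :=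
  List.IsChain.suffix h (l.dropWhile_suffix p)

variable [DecidableEq α]

/-- Left multiplication of a word by the involution `i`: the letter `i` is put in front, or
cancelled if the word already starts with it. -/
def cancelCons (i : α) : List α → List α
  | [] => [i]
  | j :: t => if i = j then t else i :: j :: t

theorem Reduced.cancelCons (i : α) {l : List α} (h : Reduced l) : Reduced (cancelCons i l) := by
  cases l with
  | nil => exact List.isChain_singleton i
  | cons j t =>
    rw [MarkoffHurwitz.cancelCons]
    split_ifs with hij
    exacts [h.tail, List.isChain_cons_cons.mpr ⟨hij, h⟩]

theorem cancelCons_eq_cons {i : α} {l : List α} (h : Reduced (i :: l)) :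
    cancelCons i l = i :: l := by
  cases l with
  | nil => rfl
  | cons j t => rw [cancelCons, if_neg (List.isChain_cons_cons.mp h).1]

theorem cancelCons_cancelCons (i : α) {l : List α} (h : Reduced l) :
    cancelCons i (cancelCons i l) = l := by
  cases l with
  | nil => simp [cancelCons]
  | cons j t =>
    rcases eq_or_ne i j with rfl | hij
    · simpa [cancelCons] using cancelCons_eq_cons h
    · simp [cancelCons, hij]

theorem dropWhile_cancelCons {I : Finset α} {i : α} (hi : i ∈ I) (l : List α) :
    (cancelCons i l).dropWhile (· ∈ I) = l.dropWhile (· ∈ I) := by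
  cases l with
  | nil => simp [cancelCons, hi]
  | cons j t =>
    rcases eq_or_ne i j with rfl | hij
    · simp [cancelCons, hi]
    · simp [cancelCons, hi, hij]

/-- `cancelCons i` as a permutation of the reduced words. -/
def cancelConsPerm (i : α) : Equiv.Perm {l : List α // Reduced l} :=
  Function.Involutive.toPerm (fun l => ⟨cancelCons i l.1, l.2.cancelCons i⟩)
    fun l => Subtype.ext (cancelCons_cancelCons i l.2)

end Words

section NormalForm

variable {n : ℕ}

/-- The action of `Γ_n` on the reduced words (van der Waerden's trick). -/
def wordAction (n : ℕ) : Gam n →* Equiv.Perm {l : List (Fin n) // Reduced l} :=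
  PresentedGroup.toGroup (f := cancelConsPerm) (by
    rintro _ ⟨i, rfl⟩
    ext1 l
    have h : cancelConsPerm i (cancelConsPerm i l) = l :=
      Subtype.ext (cancelCons_cancelCons i l.2)
    simpa [pow_two] using h)

theorem wordAction_gen (i : Fin n) : wordAction n (gen i) = cancelConsPerm i := by
  simp [wordAction, gen]

theorem gen_inv (i : Fin n) : (gen i : Gam n)⁻¹ = gen i :=
  inv_eq_of_mul_eq_one_left (gen_mul_self i)

/-- The element of `Γ_n` spelled by a word read from right to left, so that putting a letter in
front of the word is a step along an edge of the Cayley graph. -/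
def eval (l : List (Fin n)) : Gam n := l.foldr (fun i g => g * gen i) 1

theorem eval_cons (i : Fin n) (l : List (Fin n)) : eval (i :: l) = eval l * gen i := rfl

theorem eval_cancelCons (i : Fin n) (l : List (Fin n)) :
    eval (cancelCons i l) = eval l * gen i := by
  cases l with
  | nil => rfl
  | cons j t =>
    rcases eq_or_ne i j with rfl | hij
    · simp [cancelCons, eval_cons, mul_assoc, gen_mul_self]
    · simp [cancelCons, eval_cons, hij]

/-- The reduced word which spells an element of `Γ_n`. -/
def normalForm (g : Gam n) : List (Fin n) := (wordAction n g⁻¹ ⟨[], List.isChain_nil⟩).1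

theorem reduced_normalForm (g : Gam n) : Reduced (normalForm g) :=
  (wordAction n g⁻¹ ⟨[], List.isChain_nil⟩).2

theorem normalForm_one : normalForm (1 : Gam n) = [] := by simp [normalForm]

theorem normalForm_mul_gen (g : Gam n) (i : Fin n) :
    normalForm (g * gen i) = cancelCons i (normalForm g) := by
  simp only [normalForm, mul_inv_rev, gen_inv, map_mul, wordAction_gen]
  rfl

theorem normalForm_eval {l : List (Fin n)} (h : Reduced l) : normalForm (eval l) = l := by
  induction l with
  | nil => exact normalForm_one
  | cons i l ih => rw [eval_cons, normalForm_mul_gen, ih h.tail, cancelCons_eq_cons h]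

theorem eval_normalForm (g : Gam n) : eval (normalForm g) = g := by
  have step (x : Gam n) (i : Fin n) (ih : eval (normalForm x) = x) :
      eval (normalForm (x * gen i)) = x * gen i := by
    rw [normalForm_mul_gen, eval_cancelCons, ih]
  have hg : g ∈ Subgroup.closure (Set.range (gen : Fin n → Gam n)) :=
    (PresentedGroup.closure_range_of (relators n)).symm ▸ Subgroup.mem_top g
  induction hg using Subgroup.closure_induction_right with
  | one => rw [normalForm_one]; rfl
  | mul_right x _ y hy ih =>
    obtain ⟨i, rfl⟩ := hy
    exact step x i ih
  | mul_inv_cancel x _ y hy ih =>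
    obtain ⟨i, rfl⟩ := hy
    rw [gen_inv]
    exact step x i ih

/-- The image of `a` under the flips spelled by a word, the head of the word acting last. -/
def flipWord (a : Fin n → ℂ) (l : List (Fin n)) : Fin n → ℂ := l.foldr flipMap a

theorem flipWord_cons (a : Fin n → ℂ) (i : Fin n) (l : List (Fin n)) :
    flipWord a (i :: l) = flipMap i (flipWord a l) := rfl

theorem vecHurwitz_eval (a : Fin n → ℂ) (l : List (Fin n)) :
    vecHurwitz a (eval l) = flipWord a l := by
  induction l with
  | nil => simp [vecHurwitz, eval, flipWord]
  | cons i l ih => rw [flipWord_cons, ← ih, eval_cons, vecHurwitz, mul_inv_rev, gen_inv, mul_smul,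
      gen_smul, vecHurwitz]

end NormalForm

/-! ### Alternating geodesics and their roots -/

section Geodesics

variable {n : ℕ}

/-- The reduced word of the vertex of an alternating geodesic which is closest to `1`. -/
def root (γ : AltGeodesic n) : List (Fin n) :=
  γ.2.lift (fun g => (normalForm g).dropWhile (· ∈ γ.1.1)) (by
    intro v w p hp
    clear hp
    induction p with
    | nil => rfl
    | cons hadj _ ih =>
      refine Eq.trans ?_ ih
      obtain ⟨-, i, hi, rfl⟩ := hadj
      rw [normalForm_mul_gen, dropWhile_cancelCons hi])

theorem reduced_cons_root {γ : AltGeodesic n} {i : Fin n} (hi : i ∈ γ.1.1) :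
    Reduced (i :: root γ) := by
  obtain ⟨I, c⟩ := γ
  induction c using SimpleGraph.ConnectedComponent.ind with
  | h g =>
    refine List.isChain_cons.mpr ⟨?_, (reduced_normalForm g).dropWhile _⟩
    rintro j hj rfl
    change _ ∈ ((normalForm g).dropWhile (· ∈ I.1)).head? at hj
    have hne := List.ne_nil_of_mem (List.mem_of_mem_head? hj)
    have hhead := List.head_dropWhile_not (fun j => decide (j ∈ I.1)) hne
    rw [List.head_eq_iff_head?_eq_some hne |>.mpr hj] at hhead
    exact of_decide_eq_false hhead hi

theorem connectedComponentMk_mul_gen {I : Finset (Fin n)} (g : Gam n) {i : Fin n} (hi : i ∈ I) :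
    (labelGraph I).connectedComponentMk (g * gen i) = (labelGraph I).connectedComponentMk g := by
  by_cases h : g * gen i = g
  · rw [h]
  · exact SimpleGraph.ConnectedComponent.sound (SimpleGraph.Adj.reachable ⟨h, i, hi, rfl⟩)

theorem connectedComponentMk_eval_dropWhile (I : Finset (Fin n)) (l : List (Fin n)) :
    (labelGraph I).connectedComponentMk (eval (l.dropWhile (· ∈ I))) =
      (labelGraph I).connectedComponentMk (eval l) := by
  induction l with
  | nil => rfl
  | cons i l ih =>
    by_cases hi : i ∈ I
    · rw [List.dropWhile_cons_of_pos (by simpa using hi), ih, eval_cons,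
        connectedComponentMk_mul_gen _ hi]
    · rw [List.dropWhile_cons_of_neg (by simpa using hi)]

theorem connectedComponentMk_eval_root (γ : AltGeodesic n) :
    (labelGraph γ.1.1).connectedComponentMk (eval (root γ)) = γ.2 := by
  obtain ⟨I, c⟩ := γ
  induction c using SimpleGraph.ConnectedComponent.ind with
  | h g =>
    change (labelGraph I.1).connectedComponentMk (eval ((normalForm g).dropWhile (· ∈ I.1))) = _
    rw [connectedComponentMk_eval_dropWhile, eval_normalForm]

/-- The alternating geodesic with labels `i`, `j` through the vertex spelled by a word. -/
def geodesic (w : List (Fin n)) {i j : Fin n} (h : i ≠ j) : AltGeodesic n :=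
  ⟨⟨{i, j}, Finset.card_pair h⟩, (labelGraph {i, j}).connectedComponentMk (eval w)⟩

theorem root_geodesic {w : List (Fin n)} (hw : Reduced w) {i j : Fin n} (h : i ≠ j) :
    root (geodesic w h) = w.dropWhile (· ∈ ({i, j} : Finset (Fin n))) := by
  change (normalForm (eval w)).dropWhile _ = _
  rw [normalForm_eval hw]
  rfl

theorem exists_geodesic_root_eq (γ : AltGeodesic n) :
    ∃ (i j : Fin n) (h : i ≠ j), geodesic (root γ) h = γ := by
  have hγ := connectedComponentMk_eval_root γ
  generalize root γ = r at hγ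
  obtain ⟨⟨I, hI⟩, c⟩ := γ
  obtain ⟨i, j, hij, rfl⟩ := Finset.card_eq_two.mp hI
  exact ⟨i, j, hij, congrArg (Sigma.mk _) hγ⟩

theorem finite_setOf_length_root_le (N : ℕ) : {γ : AltGeodesic n | (root γ).length ≤ N}.Finite := by
  refine (((List.finite_length_le (Fin n) N).prod Set.finite_univ).image fun p :
    List (Fin n) × {I : Finset (Fin n) // I.card = 2} => (⟨p.2,
      (labelGraph p.2.1).connectedComponentMk (eval p.1)⟩ : AltGeodesic n)).subset ?_
  intro γ hγ
  exact ⟨(root γ, γ.1), ⟨hγ, Set.mem_univ _⟩,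
    Sigma.ext rfl (heq_of_eq (connectedComponentMk_eval_root γ))⟩

end Geodesics

/-! ### Products of coordinates -/

section Products

variable {ι M : Type*} [Fintype ι] [DecidableEq ι] [CommMonoid M]

/-- The product of all coordinates of `x` except the `i`-th one. -/
def prodErase (x : ι → M) (i : ι) : M := ∏ k ∈ Finset.univ.erase i, x k

/-- The product of all coordinates of `x` except the `i`-th and the `j`-th one; for `x = Φ_a(g)`
this is the value of `φ_a` at the alternating geodesic with labels `i`, `j` through `g`. -/
def prodErasePair (x : ι → M) (i j : ι) : M := ∏ k ∈ ({i, j} : Finset ι)ᶜ, x k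

theorem prodErasePair_comm (x : ι → M) (i j : ι) : prodErasePair x i j = prodErasePair x j i := by
  rw [prodErasePair, prodErasePair, Finset.pair_comm]

theorem prodErase_eq_prodErasePair_mul (x : ι → M) {i j : ι} (h : j ≠ i) :
    prodErase x i = prodErasePair x i j * x j := by
  rw [prodErase, ← Finset.prod_erase_mul _ _ (Finset.mem_erase.mpr ⟨h, Finset.mem_univ j⟩),
    prodErasePair]
  congr 2
  ext k
  simp [and_comm]

theorem mul_prodErase (x : ι → M) (i : ι) : x i * prodErase x i = ∏ k, x k :=
  Finset.mul_prod_erase _ _ (Finset.mem_univ i)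

theorem prodErasePair_eq_mul_prod (x : ι → M) {i j k : ι} (hi : k ≠ i) (hj : k ≠ j) :
    prodErasePair x i j = x k * ∏ l ∈ ({i, j, k} : Finset ι)ᶜ, x l := by
  rw [prodErasePair, ← Finset.mul_prod_erase _ _ (a := k) (by simp [hi, hj])]
  congr 2
  ext l
  simp only [Finset.mem_erase, Finset.mem_compl, Finset.mem_insert, Finset.mem_singleton]
  tauto

theorem prodErase_congr {x y : ι → M} {i : ι} (h : ∀ k, k ≠ i → x k = y k) :
    prodErase x i = prodErase y i :=
  Finset.prod_congr rfl fun k hk => h k (Finset.ne_of_mem_erase hk)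

theorem prodErasePair_congr {x y : ι → M} {i j : ι} (h : ∀ k, k ≠ i → k ≠ j → x k = y k) :
    prodErasePair x i j = prodErasePair y i j :=
  Finset.prod_congr rfl fun k hk => by
    simp only [Finset.mem_compl, Finset.mem_insert, Finset.mem_singleton, not_or] at hk
    exact h k hk.1 hk.2

end Products

section NormProducts

variable {ι 𝕜 : Type*} [Fintype ι] [DecidableEq ι] [NormedField 𝕜] {x y : ι → 𝕜}

theorem norm_prodErase_le_norm_prodErase (h : ∀ k, ‖x k‖ ≤ ‖y k‖) (i : ι) :
    ‖prodErase x i‖ ≤ ‖prodErase y i‖ := by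
  simp only [prodErase, norm_prod]
  exact Finset.prod_le_prod (fun _ _ => norm_nonneg _) fun k _ => h k

theorem norm_prodErasePair_le_norm_prodErasePair (h : ∀ k, ‖x k‖ ≤ ‖y k‖) (i j : ι) :
    ‖prodErasePair x i j‖ ≤ ‖prodErasePair y i j‖ := by
  simp only [prodErasePair, norm_prod]
  exact Finset.prod_le_prod (fun _ _ => norm_nonneg _) fun k _ => h k

theorem norm_prodErasePair_le_of_norm_le {i j k : ι} (hi : k ≠ i) (hj : k ≠ j)
    (h : ‖x j‖ ≤ ‖x i‖) : ‖prodErasePair x i k‖ ≤ ‖prodErasePair x j k‖ := by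
  rcases eq_or_ne i j with rfl | hij
  · rfl
  have e : ({i, k, j} : Finset ι) = {j, k, i} := by ext; simp; tauto
  rw [prodErasePair_eq_mul_prod x hij.symm hj.symm, prodErasePair_eq_mul_prod x hij hi.symm, e,
    norm_mul, norm_mul]
  gcongr

end NormProducts

section FlipMap

variable {n : ℕ}

theorem flipMap_self (x : Fin n → ℂ) (i : Fin n) : flipMap i x i = prodErase x i - x i := by
  simp [flipMap, prodErase]

theorem flipMap_of_ne (x : Fin n → ℂ) {i k : Fin n} (h : k ≠ i) : flipMap i x k = x k := by
  simp [flipMap, h]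

theorem prodErase_flipMap (x : Fin n → ℂ) (i : Fin n) :
    prodErase (flipMap i x) i = prodErase x i :=
  prodErase_congr fun _ => flipMap_of_ne x

theorem prodErasePair_flipMap (x : Fin n → ℂ) (i j : Fin n) :
    prodErasePair (flipMap i x) i j = prodErasePair x i j :=
  prodErasePair_congr fun _ hi _ => flipMap_of_ne x hi

theorem continuous_prodErase (i : Fin n) : Continuous fun x : Fin n → ℂ => prodErase x i :=
  continuous_finsetProd _ fun k _ => continuous_apply k

theorem continuous_prodErasePair (i j : Fin n) :
    Continuous fun x : Fin n → ℂ => prodErasePair x i j :=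
  continuous_finsetProd _ fun k _ => continuous_apply k

theorem continuous_flipMap (i : Fin n) : Continuous (flipMap (n := n) i) :=
  continuous_id.update i ((continuous_prodErase i).sub (continuous_apply i))

theorem continuous_flipWord (l : List (Fin n)) :
    Continuous fun a : Fin n → ℂ => flipWord a l := by
  induction l with
  | nil => exact continuous_id
  | cons i l ih => exact (continuous_flipMap i).comp ih

theorem extHurwitz_geodesic (a : Fin n → ℂ) (w : List (Fin n)) {i j : Fin n} (h : i ≠ j) :
    extHurwitz a (geodesic w h) = prodErasePair (flipWord a w) i j := by
  rw [geodesic, extHurwitz_mk, vecHurwitz_eval, prodErasePair]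

end FlipMap

/-! ### The recurrence `y (m + 2) = (l + l⁻¹) * y (m + 1) - y m` -/

section Recurrence

/-- The closed interval `[-2, 2]` in the complex plane; `c = l + l⁻¹` avoids it if and only if `l`
can be chosen off the unit circle. -/
def cutInterval : Set ℂ := Complex.ofReal '' Set.Icc (-2 : ℝ) 2

theorem isClosed_cutInterval : IsClosed cutInterval :=
  (isCompact_Icc.image Complex.continuous_ofReal).isClosed

theorem zero_mem_cutInterval : (0 : ℂ) ∈ cutInterval := ⟨0, by norm_num, by simp⟩

theorem notMem_cutInterval_of_lt_norm {z : ℂ} (h : 2 < ‖z‖) : z ∉ cutInterval := by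
  rintro ⟨t, ht, rfl⟩
  rw [Complex.norm_real, Real.norm_eq_abs] at h
  exact absurd (abs_le.mpr ht) h.not_ge

theorem exists_add_inv_eq {c : ℂ} (hc : c ∉ cutInterval) : ∃ l : ℂ, 1 < ‖l‖ ∧ l + l⁻¹ = c := by
  obtain ⟨s, hs⟩ := IsAlgClosed.exists_pow_nat_eq (c ^ 2 - 4) (n := 2) (by norm_num)
  obtain ⟨l, hl⟩ : ∃ l, l = (c + s) / 2 := ⟨_, rfl⟩
  have hmul : l * (c - l) = 1 := by
    rw [hl]; linear_combination -hs / 4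
  have hl0 : l ≠ 0 := left_ne_zero_of_mul_eq_one hmul
  have hinv : l⁻¹ = c - l := inv_eq_of_mul_eq_one_right hmul
  rcases lt_trichotomy ‖l‖ 1 with h | h | h
  · refine ⟨l⁻¹, ?_, by rw [inv_inv, hinv]; ring⟩
    rw [norm_inv]
    exact (one_lt_inv₀ (norm_pos_iff.mpr hl0)).mpr h
  · refine absurd ?_ hc
    have hconj : l⁻¹ = (starRingEnd ℂ) l := Complex.inv_eq_conj h
    have hre : c = ((2 * l.re : ℝ) : ℂ) := by
      rw [← Complex.add_conj, ← hconj, hinv]; ring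
    have hle := abs_le.mp ((Complex.abs_re_le_norm l).trans h.le)
    exact ⟨2 * l.re, ⟨by linarith [hle.1], by linarith [hle.2]⟩, hre.symm⟩
  · exact ⟨l, h, by rw [hinv]; ring⟩

variable {𝕜 : Type*} [NormedField 𝕜] {l A B : 𝕜}

/-- The general solution of the recurrence `y (m + 2) = (l + l⁻¹) * y (m + 1) - y m`. -/
def binet (l A B : 𝕜) (m : ℕ) : 𝕜 := A * l ^ m + B * l⁻¹ ^ m

theorem binet_add_two (hl : l ≠ 0) (m : ℕ) :
    binet l A B (m + 2) = (l + l⁻¹) * binet l A B (m + 1) - binet l A B m := by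
  simp only [binet]
  linear_combination -(A * l ^ m + B * l⁻¹ ^ m) * mul_inv_cancel₀ hl

theorem binet_succ_sub_mul (m : ℕ) :
    binet l A B (m + 1) - l * binet l A B m = (l⁻¹ - l) * B * l⁻¹ ^ m := by
  simp only [binet]
  ring

theorem exists_binet_eq (hl : 1 < ‖l‖) (y₀ y₁ : 𝕜) :
    ∃ A B, binet l A B 0 = y₀ ∧ binet l A B 1 = y₁ := by
  have hl0 : l ≠ 0 := norm_pos_iff.mp (one_pos.trans hl)
  have hne : l ^ 2 - 1 ≠ 0 := fun h => by
    have := congrArg norm (sub_eq_zero.mp h)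
    rw [norm_pow, norm_one] at this
    exact (one_lt_pow₀ hl two_ne_zero).ne' this
  refine ⟨(y₁ * l - y₀) / (l ^ 2 - 1), (l * y₀ - y₁) * l / (l ^ 2 - 1), ?_, ?_⟩
  · simp only [binet, pow_zero]
    field_simp
    ring
  · simp only [binet, pow_one]
    field_simp
    ring

theorem tendsto_inv_pow_zero (hl : 1 < ‖l‖) :
    Filter.Tendsto (fun m : ℕ => l⁻¹ ^ m) Filter.atTop (nhds 0) :=
  tendsto_pow_atTop_nhds_zero_of_norm_lt_one (by
    rw [norm_inv]; exact inv_lt_one_of_one_lt₀ hl)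

theorem tendsto_binet_zero (hl : 1 < ‖l‖) :
    Filter.Tendsto (binet l 0 B) Filter.atTop (nhds 0) := by
  have h : binet l 0 B = fun m => B * l⁻¹ ^ m := by funext m; simp [binet]
  simpa only [h, mul_zero] using (tendsto_inv_pow_zero hl).const_mul B

theorem tendsto_norm_binet_atTop (hl : 1 < ‖l‖) (hA : A ≠ 0) :
    Filter.Tendsto (fun m => ‖binet l A B m‖) Filter.atTop Filter.atTop := by
  have hgrow : Filter.Tendsto (fun m : ℕ => ‖A‖ * ‖l‖ ^ m) Filter.atTop Filter.atTop :=
    (tendsto_pow_atTop_atTop_of_one_lt hl).const_mul_atTop (norm_pos_iff.mpr hA)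
  have hsmall : Filter.Tendsto (fun m : ℕ => -‖B * l⁻¹ ^ m‖) Filter.atTop (nhds 0) := by
    simpa using ((tendsto_inv_pow_zero hl).const_mul B).norm.neg
  refine Filter.tendsto_atTop_mono (fun m => ?_) (hgrow.atTop_add hsmall)
  rw [← norm_pow, ← norm_mul, ← sub_eq_add_neg, binet]
  simpa using norm_sub_norm_le (A * l ^ m) (-(B * l⁻¹ ^ m))

/-- `z / w` is closer than `‖l‖ - ρ` to a root `l` of `l + l⁻¹ = c`. If `1 ≤ ρ`, this is stable
under the step `(w, z) ↦ (z, c * z - w)` of the recurrence. -/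
def InCone (ρ : ℝ) (c z w : 𝕜) : Prop := ∃ l, l + l⁻¹ = c ∧ ‖z - l * w‖ < (‖l‖ - ρ) * ‖w‖

variable {ρ : ℝ} {c z w : 𝕜}

theorem InCone.mul_norm_lt (h : InCone ρ c z w) : ρ * ‖w‖ < ‖z‖ := by
  obtain ⟨l, -, h⟩ := h
  have := norm_sub_norm_le (l * w) z
  rw [norm_sub_rev, norm_mul] at this
  linarith

theorem InCone.step (hρ : 1 ≤ ρ) (h : InCone ρ c z w) : InCone ρ c (c * z - w) z := by
  have hwz : ‖w‖ ≤ ‖z‖ := (le_mul_of_one_le_left (norm_nonneg w) hρ).trans h.mul_norm_lt.le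
  obtain ⟨l, rfl, h⟩ := h
  have hl : ρ < ‖l‖ := sub_pos.mp (pos_of_mul_pos_left ((norm_nonneg _).trans_lt h) (norm_nonneg w))
  have hl0 : l ≠ 0 := norm_pos_iff.mp (by linarith)
  refine ⟨l, rfl, ?_⟩
  calc ‖(l + l⁻¹) * z - w - l * z‖ = ‖l‖⁻¹ * ‖z - l * w‖ := by
        rw [← norm_inv, ← norm_mul]; congr 1; field_simp; ring
    _ ≤ ‖z - l * w‖ := mul_le_of_le_one_left (norm_nonneg _) (inv_le_one_of_one_le₀ (by linarith))
    _ < (‖l‖ - ρ) * ‖w‖ := h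
    _ ≤ (‖l‖ - ρ) * ‖z‖ := by gcongr

theorem eventually_inCone_binet (hρ : 1 ≤ ρ) (hl : ρ < ‖l‖) (hA : A ≠ 0) :
    ∀ᶠ m in Filter.atTop, InCone ρ (l + l⁻¹) (binet l A B (m + 1)) (binet l A B m) := by
  have hl1 : 1 < ‖l‖ := hρ.trans_lt hl
  have hsmall : Filter.Tendsto (fun m : ℕ => ‖(l⁻¹ - l) * B * l⁻¹ ^ m‖) Filter.atTop (nhds 0) := by
    simpa using ((tendsto_inv_pow_zero hl1).const_mul ((l⁻¹ - l) * B)).norm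
  have hlarge := (tendsto_norm_binet_atTop (B := B) hl1 hA).const_mul_atTop (sub_pos.mpr hl)
  filter_upwards [hsmall.eventually_lt_const one_pos, hlarge.eventually_gt_atTop 1] with m hm hm'
  refine ⟨l, rfl, ?_⟩
  rw [binet_succ_sub_mul]
  exact hm.trans hm'

/-- The parameter `l` of the cone depends on `c` through an open map. -/
theorem isOpen_setOf_inCone (hρ : 1 ≤ ρ) :
    IsOpen {p : ℂ × ℂ × ℂ | InCone ρ p.1 p.2.1 p.2.2} := by
  rw [isOpen_iff_mem_nhds]
  rintro ⟨_, z, w⟩ ⟨l, rfl, h⟩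
  have hl : ρ < ‖l‖ := sub_pos.mp (pos_of_mul_pos_left ((norm_nonneg _).trans_lt h) (norm_nonneg w))
  have hl0 : l ≠ 0 := norm_pos_iff.mp (by linarith)
  have hderiv : HasStrictDerivAt (fun l : ℂ => l + l⁻¹) (1 + -(l ^ 2)⁻¹) l :=
    (hasStrictDerivAt_id l).add (hasStrictDerivAt_inv hl0)
  have hderiv_ne : 1 + -(l ^ 2)⁻¹ ≠ 0 := fun h0 => by
    have := congrArg norm (inv_eq_one.mp (add_neg_eq_zero.mp h0).symm)
    rw [norm_pow, norm_one] at this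
    exact (one_lt_pow₀ (hρ.trans_lt hl) two_ne_zero).ne' this
  have hmap : Filter.map (Prod.map (fun l : ℂ => l + l⁻¹) id) (nhds (l, z, w)) =
      nhds (l + l⁻¹, z, w) := by
    rw [nhds_prod_eq, ← Filter.prod_map_map_eq', hderiv.map_nhds_eq hderiv_ne, Filter.map_id,
      ← nhds_prod_eq]
  have hopen : IsOpen {p : ℂ × ℂ × ℂ | ‖p.2.1 - p.1 * p.2.2‖ < (‖p.1‖ - ρ) * ‖p.2.2‖} :=
    isOpen_lt (by fun_prop) (by fun_prop)
  rw [← hmap]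
  filter_upwards [Filter.image_mem_map (hopen.mem_nhds h)]
  rintro _ ⟨⟨l', p⟩, hl', rfl⟩
  exact ⟨l', rfl, hl'⟩

end Recurrence

/-! ### Points from which the flips expand -/

section Expanding

variable {n : ℕ}

/-- All values of `φ_a` at the alternating geodesics through the vertex with `Φ_a = x` which have
`i` among their labels exceed `K` in modulus. -/
def LargeAt (K : ℝ) (x : Fin n → ℂ) (i : Fin n) : Prop := ∀ j, j ≠ i → K < ‖prodErasePair x i j‖

/-- The flip of the `i`-th coordinate makes it smaller; moreover the products are large. -/
def Dominant (ρ : ℝ) (x : Fin n → ℂ) (i : Fin n) : Prop :=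
  ‖prodErase x i‖ < 2 * ‖x i‖ ∧ LargeAt (2 * ρ) x i

/-- The flip of the `i`-th coordinate makes it larger; moreover the products are large. -/
def Recessive (ρ : ℝ) (x : Fin n → ℂ) (i : Fin n) : Prop :=
  2 * ‖x i‖ < ‖prodErase x i‖ ∧ LargeAt (2 * ρ) x i

/-- The point `x` lies far out on an alternating geodesic with labels `i`, `j`, reached by a flip
of the `i`-th coordinate: the coordinates `i` and `j` go on growing along this geodesic, and every
flip which leaves it leads to a dominant coordinate. -/
def Tail (ρ : ℝ) (x : Fin n → ℂ) (i j : Fin n) : Prop :=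
  1 < ‖x j‖ ∧ InCone ρ (prodErasePair x i j) (x i) (x j) ∧ ∀ k, k ≠ i → k ≠ j → Recessive ρ x k

/-- All further flips, starting with one of a coordinate different from `i`, make the coordinates
grow; see `Expanding.flip`. -/
def Expanding (ρ : ℝ) (x : Fin n → ℂ) (i : Fin n) : Prop :=
  Dominant ρ x i ∨ ∃ j, j ≠ i ∧ Tail ρ x i j

variable {x y : Fin n → ℂ} {i j k : Fin n} {ρ : ℝ}

theorem Recessive.dominant_flip (h : Recessive ρ x i) : Dominant ρ (flipMap i x) i := by
  refine ⟨?_, fun j hj => ?_⟩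
  · rw [prodErase_flipMap, flipMap_self]
    linarith [norm_sub_norm_le (prodErase x i) (x i), h.1]
  · rw [prodErasePair_flipMap]
    exact h.2 j hj

theorem Recessive.mono (h : Recessive ρ x i) (hi : y i = x i) (hxy : ∀ k, ‖x k‖ ≤ ‖y k‖) :
    Recessive ρ y i :=
  ⟨hi ▸ h.1.trans_le (norm_prodErase_le_norm_prodErase hxy i),
    fun j hj => (h.2 j hj).trans_le (norm_prodErasePair_le_norm_prodErasePair hxy i j)⟩

theorem LargeAt.lt_norm_prodErase (hn : 2 ≤ n) {K : ℝ} (hK : 1 ≤ K) (h : LargeAt K x i) :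
    K < ‖prodErase x i‖ := by
  have := Fin.nontrivial_iff_two_le.mpr hn
  obtain ⟨j, hj⟩ := exists_ne i
  by_cases hx : ∃ k, k ≠ i ∧ 1 ≤ ‖x k‖
  · obtain ⟨k, hk, hxk⟩ := hx
    rw [prodErase_eq_prodErasePair_mul x hk, norm_mul]
    exact (h k hk).trans_le (le_mul_of_one_le_right (norm_nonneg _) hxk)
  · push Not at hx
    refine absurd (h j hj) (not_lt.mpr (le_trans ?_ hK))
    rw [prodErasePair, norm_prod]
    refine Finset.prod_le_one (fun _ _ => norm_nonneg _) fun k hk => (hx k ?_).le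
    rintro rfl
    simp at hk

theorem LargeAt.mul_norm_le (h : LargeAt (2 * ρ) x i) (hx : ‖prodErase x i‖ ≤ 2 * ‖x i‖)
    (hj : j ≠ i) : ρ * ‖x j‖ ≤ ‖x i‖ := by
  rw [prodErase_eq_prodErasePair_mul x hj, norm_mul] at hx
  have := mul_le_mul_of_nonneg_right (h j hj).le (norm_nonneg (x j))
  linarith

theorem LargeAt.mul_norm_le_norm_prodErase {K : ℝ} (h : LargeAt K x i) (hj : j ≠ i) :
    K * ‖x i‖ ≤ ‖prodErase x j‖ := by
  rw [prodErase_eq_prodErasePair_mul x hj.symm, norm_mul, prodErasePair_comm]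
  exact mul_le_mul_of_nonneg_right (h j hj).le (norm_nonneg _)

theorem LargeAt.of_norm_le {K : ℝ} (h : LargeAt K x i) (hx : ‖x j‖ ≤ ‖x i‖) (hj : j ≠ i) :
    LargeAt K x j := by
  intro k hk
  rcases eq_or_ne k i with rfl | hki
  · rw [prodErasePair_comm]
    exact h j hj
  · exact (h k hki).trans_le (norm_prodErasePair_le_of_norm_le hki hk hx)

theorem Dominant.norm_pos (h : Dominant ρ x i) : 0 < ‖x i‖ := by
  linarith [h.1, norm_nonneg (prodErase x i)]

theorem Dominant.mul_norm_le (h : Dominant ρ x i) (hj : j ≠ i) : ρ * ‖x j‖ ≤ ‖x i‖ :=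
  h.2.mul_norm_le h.1.le hj

theorem Dominant.recessive (hρ : 1 < ρ) (h : Dominant ρ x i) (hj : j ≠ i) : Recessive ρ x j := by
  have hji : ‖x j‖ ≤ ‖x i‖ :=
    (le_mul_of_one_le_left (norm_nonneg _) hρ.le).trans (h.mul_norm_le hj)
  refine ⟨?_, h.2.of_norm_le hji hj⟩
  calc 2 * ‖x j‖ ≤ 2 * ‖x i‖ := by gcongr
    _ < 2 * ρ * ‖x i‖ := mul_lt_mul_of_pos_right (by linarith) h.norm_pos
    _ ≤ ‖prodErase x j‖ := h.2.mul_norm_le_norm_prodErase hj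

theorem Dominant.one_le_norm (hn : 2 ≤ n) (hρ : 1 < ρ) (h : Dominant ρ x i) : 1 ≤ ‖x i‖ := by
  linarith [h.2.lt_norm_prodErase hn (by linarith), h.1]

theorem Tail.flip (hρ : 1 ≤ ρ) (hj : j ≠ i) (h : Tail ρ x i j) : Tail ρ (flipMap j x) j i := by
  obtain ⟨hxj, hcone, hrec⟩ := h
  have hxi : ‖x j‖ ≤ ‖x i‖ :=
    (le_mul_of_one_le_left (norm_nonneg _) hρ).trans hcone.mul_norm_lt.le
  have hcone' : InCone ρ (prodErasePair x j i) (flipMap j x j) (x i) := by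
    rw [flipMap_self, prodErase_eq_prodErasePair_mul x hj.symm, prodErasePair_comm]
    exact hcone.step hρ
  have hle (k : Fin n) : ‖x k‖ ≤ ‖flipMap j x k‖ := by
    rcases eq_or_ne k j with rfl | hk
    · exact hxi.trans ((le_mul_of_one_le_left (norm_nonneg _) hρ).trans hcone'.mul_norm_lt.le)
    · rw [flipMap_of_ne x hk]
  refine ⟨?_, ?_, fun k hkj hki => (hrec k hki hkj).mono (flipMap_of_ne x hkj) hle⟩
  · rw [flipMap_of_ne x hj.symm]
    exact hxj.trans_le hxi
  · rwa [prodErasePair_flipMap, flipMap_of_ne x hj.symm]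

theorem Expanding.recessive_or_tail (hρ : 1 < ρ) (h : Expanding ρ x i) (hj : j ≠ i) :
    Recessive ρ x j ∨ Tail ρ x i j := by
  rcases h with h | ⟨p, -, h⟩
  · exact Or.inl (h.recessive hρ hj)
  · rcases eq_or_ne j p with rfl | hjp
    · exact Or.inr h
    · exact Or.inl (h.2.2 j hj hjp)

theorem Expanding.flip (hρ : 1 < ρ) (h : Expanding ρ x i) (hj : j ≠ i) :
    Expanding ρ (flipMap j x) j := by
  rcases h.recessive_or_tail hρ hj with hrec | htail
  · exact Or.inl hrec.dominant_flip
  · exact Or.inr ⟨i, hj.symm, htail.flip hρ.le hj⟩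

theorem Expanding.mul_norm_le_norm_flip (hρ : 1 < ρ)
    (h : Expanding ρ x i) (hj : j ≠ i) : ρ * ‖x i‖ ≤ ‖flipMap j x j‖ := by
  rw [← flipMap_of_ne x hj.symm]
  rcases h.recessive_or_tail hρ hj with hrec | htail
  · exact hrec.dominant_flip.mul_norm_le hj.symm
  · exact (htail.flip hρ.le hj).2.1.mul_norm_lt.le

theorem Expanding.one_le_norm (hn : 2 ≤ n) (hρ : 1 < ρ) (h : Expanding ρ x i) :
    1 ≤ ‖x i‖ := by
  rcases h with h | ⟨j, -, hxj, hcone, -⟩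
  · exact h.one_le_norm hn hρ
  · exact (hxj.le.trans (le_mul_of_one_le_left (norm_nonneg _) hρ.le)).trans hcone.mul_norm_lt.le

theorem Expanding.lt_norm_prodErasePair (hρ : 1 < ρ) (h : Expanding ρ x i) (hj : j ≠ i)
    (hk : k ≠ i) (hjk : j ≠ k) : 2 * ρ < ‖prodErasePair x j k‖ := by
  rcases h.recessive_or_tail hρ hj with hrec | htail
  · exact hrec.2 k hjk.symm
  · rw [prodErasePair_comm]
    exact (htail.2.2 k hk hjk.symm).2 j hjk

theorem isOpen_setOf_largeAt (K : ℝ) (i : Fin n) : IsOpen {x : Fin n → ℂ | LargeAt K x i} := by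
  simp only [LargeAt, Set.ofPred_forall]
  exact isOpen_iInter_of_finite fun j => isOpen_iInter_of_finite fun _ =>
    isOpen_lt continuous_const (continuous_prodErasePair i j).norm

theorem isOpen_setOf_dominant (ρ : ℝ) (i : Fin n) : IsOpen {x : Fin n → ℂ | Dominant ρ x i} :=
  (isOpen_lt (continuous_prodErase i).norm (continuous_const.mul (continuous_apply i).norm)).inter
    (isOpen_setOf_largeAt (2 * ρ) i)

theorem isOpen_setOf_recessive (ρ : ℝ) (i : Fin n) : IsOpen {x : Fin n → ℂ | Recessive ρ x i} :=
  (isOpen_lt (continuous_const.mul (continuous_apply i).norm) (continuous_prodErase i).norm).inter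
    (isOpen_setOf_largeAt (2 * ρ) i)

theorem isOpen_setOf_tail (hρ : 1 ≤ ρ) (i j : Fin n) :
    IsOpen {x : Fin n → ℂ | Tail ρ x i j} := by
  have hcone : IsOpen {x : Fin n → ℂ | InCone ρ (prodErasePair x i j) (x i) (x j)} :=
    (isOpen_setOf_inCone hρ).preimage ((continuous_prodErasePair i j).prodMk
      ((continuous_apply i).prodMk (continuous_apply j)))
  have hrec : IsOpen {x : Fin n → ℂ | ∀ k, k ≠ i → k ≠ j → Recessive ρ x k} := by
    simp only [Set.ofPred_forall]
    exact isOpen_iInter_of_finite fun k => isOpen_iInter_of_finite fun _ =>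
      isOpen_iInter_of_finite fun _ => isOpen_setOf_recessive ρ k
  exact (isOpen_lt continuous_const (continuous_apply j).norm).inter (hcone.inter hrec)

theorem isOpen_setOf_expanding (hρ : 1 ≤ ρ) (i : Fin n) :
    IsOpen {x : Fin n → ℂ | Expanding ρ x i} := by
  simp only [Expanding, Set.ofPred_or, Set.ofPred_exists, Set.ofPred_and]
  exact (isOpen_setOf_dominant ρ i).union
    (isOpen_iUnion fun j => isOpen_const.inter (isOpen_setOf_tail hρ i j))

end Expanding

section ExpandsFrom

variable {n : ℕ}

/-- All reduced words with more than `N` letters lead from `a` to points from which the flips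
expand; by `Expanding.flip` it suffices to consider the words with `N + 1` letters. -/
def ExpandsFrom (ρ : ℝ) (N : ℕ) (a : Fin n → ℂ) : Prop :=
  ∀ i l, Reduced (i :: l) → l.length = N → Expanding ρ (flipWord a (i :: l)) i

variable {a : Fin n → ℂ} {ρ : ℝ} {N : ℕ} {i : Fin n} {l : List (Fin n)}

theorem ExpandsFrom.expanding (hρ : 1 < ρ) (h : ExpandsFrom ρ N a) (hr : Reduced (i :: l))
    (hl : N ≤ l.length) : Expanding ρ (flipWord a (i :: l)) i := by
  induction l generalizing i with
  | nil => exact h i [] hr (by simpa using hl.antisymm')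
  | cons j l ih =>
    rcases hl.eq_or_lt with hl | hl
    · exact h i _ hr hl.symm
    · exact (ih hr.tail (Nat.lt_succ_iff.mp hl)).flip hρ (List.isChain_cons_cons.mp hr).1

theorem ExpandsFrom.pow_le_norm (hn : 2 ≤ n) (hρ : 1 < ρ) (h : ExpandsFrom ρ N a)
    (hr : Reduced (i :: l)) (hl : N ≤ l.length) :
    ρ ^ (l.length - N) ≤ ‖flipWord a (i :: l) i‖ := by
  induction l generalizing i with
  | nil => simpa using (h.expanding hρ hr hl).one_le_norm hn hρ
  | cons j l ih =>
    rcases hl.eq_or_lt with hl' | hl'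
    · simpa [← hl'] using (h.expanding hρ hr hl).one_le_norm hn hρ
    · have hl' : N ≤ l.length := Nat.lt_succ_iff.mp hl'
      rw [List.length_cons, Nat.sub_add_comm hl', pow_succ']
      calc ρ * ρ ^ (l.length - N) ≤ ρ * ‖flipWord a (j :: l) j‖ := by gcongr; exact ih hr.tail hl'
        _ ≤ ‖flipWord a (i :: j :: l) i‖ :=
          (h.expanding hρ hr.tail hl').mul_norm_le_norm_flip hρ (List.isChain_cons_cons.mp hr).1

theorem ExpandsFrom.lt_norm_extHurwitz (hρ : 1 < ρ) (h : ExpandsFrom ρ N a) {γ : AltGeodesic n}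
    (hγ : N < (root γ).length) : 2 * ρ < ‖extHurwitz a γ‖ := by
  obtain ⟨i, j, hij, hw⟩ := exists_geodesic_root_eq γ
  have hi : Reduced (i :: root γ) := reduced_cons_root (hw ▸ Finset.mem_insert_self i {j})
  have hj : Reduced (j :: root γ) :=
    reduced_cons_root (hw ▸ Finset.mem_insert_of_mem (Finset.mem_singleton_self j))
  rw [← hw, extHurwitz_geodesic]
  cases hl : root γ with
  | nil => simp [hl] at hγ
  | cons k l =>
    rw [hl] at hi hj hγ
    exact (h.expanding hρ hi.tail (Nat.lt_succ_iff.mp hγ)).lt_norm_prodErasePair hρ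
      (List.isChain_cons_cons.mp hi).1 (List.isChain_cons_cons.mp hj).1 hij

theorem ExpandsFrom.mem_bowditchDomain (hρ : 1 < ρ) (h : ExpandsFrom ρ N a)
    (hshort : ∀ l : List (Fin n), l.length ≤ N →
      ∀ i j, i ≠ j → prodErasePair (flipWord a l) i j ∉ cutInterval) :
    a ∈ bowditchDomain n := by
  refine ⟨fun γ => ?_, 2 * ρ, by linarith, (finite_setOf_length_root_le N).subset fun γ hγ => ?_⟩
  · rcases lt_or_ge N (root γ).length with hγ | hγ
    · exact notMem_cutInterval_of_lt_norm (lt_trans (by linarith) (h.lt_norm_extHurwitz hρ hγ))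
    · obtain ⟨i, j, hij, hw⟩ := exists_geodesic_root_eq γ
      rw [← hw, extHurwitz_geodesic]
      exact hshort _ hγ i j hij
  · exact not_lt.mp fun hlt => (h.lt_norm_extHurwitz hρ hlt).not_ge hγ

theorem recessive_const_four (hn : 3 ≤ n) (i : Fin n) :
    Recessive (3 / 2) (fun _ : Fin n => (4 : ℂ)) i := by
  have hpair {j : Fin n} (hj : j ≠ i) :
      4 ≤ ‖prodErasePair (fun _ : Fin n => (4 : ℂ)) i j‖ := by
    rw [prodErasePair, Finset.prod_const, Finset.card_compl, Finset.card_pair hj.symm,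
      Fintype.card_fin, norm_pow, Complex.norm_ofNat]
    exact le_self_pow₀ (by norm_num) (by omega)
  have := Fin.nontrivial_iff_two_le.mpr (by omega : 2 ≤ n)
  obtain ⟨j, hj⟩ := exists_ne i
  refine ⟨?_, fun j hj => lt_of_lt_of_le (by norm_num) (hpair hj)⟩
  rw [prodErase_eq_prodErasePair_mul _ hj, norm_mul, Complex.norm_ofNat]
  linarith [hpair hj]

theorem bowditchDomain_nonempty (hn : 3 ≤ n) : (bowditchDomain n).Nonempty := by
  refine ⟨fun _ => 4, ExpandsFrom.mem_bowditchDomain (ρ := 3 / 2) (N := 0) (by norm_num) ?_ ?_⟩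
  · intro i l _ hl
    obtain rfl := List.length_eq_zero_iff.mp hl
    exact Or.inl (recessive_const_four hn i).dominant_flip
  · intro l hl i j hij
    obtain rfl := List.length_eq_zero_iff.mp (Nat.le_zero.mp hl)
    have := (recessive_const_four hn i).2 j hij.symm
    exact notMem_cutInterval_of_lt_norm (lt_trans (by norm_num) this)

theorem isOpen_setOf_expandsFrom (hρ : 1 ≤ ρ) (N : ℕ) :
    IsOpen {a : Fin n → ℂ | ExpandsFrom ρ N a} := by
  have h : {a : Fin n → ℂ | ExpandsFrom ρ N a} = ⋂ i, ⋂ l ∈ {l | Reduced (i :: l) ∧ l.length = N},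
      {a | Expanding ρ (flipWord a (i :: l)) i} := by
    ext a
    simp [ExpandsFrom]
  rw [h]
  exact isOpen_iInter_of_finite fun i =>
    ((List.finite_length_eq (Fin n) N).subset fun _ h => h.2).isOpen_biInter fun l _ =>
      (isOpen_setOf_expanding hρ i).preimage (continuous_flipWord (i :: l))

theorem isOpen_setOf_forall_notMem_cutInterval (N : ℕ) :
    IsOpen {a : Fin n → ℂ | ∀ l : List (Fin n), l.length ≤ N →
      ∀ i j, i ≠ j → prodErasePair (flipWord a l) i j ∉ cutInterval} := by
  simp only [Set.ofPred_forall]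
  exact (List.finite_length_le (Fin n) N).isOpen_biInter fun l _ =>
    isOpen_iInter_of_finite fun i => isOpen_iInter_of_finite fun j =>
      isOpen_iInter_of_finite fun _ => isClosed_cutInterval.isOpen_compl.preimage
        ((continuous_prodErasePair i j).comp (continuous_flipWord l))

theorem ExpandsFrom.length_normalForm_le (hn : 2 ≤ n) (hρ : 1 < ρ) (h : ExpandsFrom ρ N a)
    {R : ℝ} {M : ℕ} (hM : R < ρ ^ M) {g : Gam n} (hg : ‖vecHurwitz a g‖ ≤ R) :
    (normalForm g).length ≤ N + M := by
  by_contra! hlt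
  have hr := reduced_normalForm g
  rw [← eval_normalForm g, vecHurwitz_eval] at hg
  cases hw : normalForm g with
  | nil => simp [hw] at hlt
  | cons i w =>
    rw [hw] at hr hg hlt
    have hlen : N + M ≤ w.length := Nat.lt_succ_iff.mp hlt
    refine absurd hg (not_le.mpr (hM.trans_le ?_))
    calc ρ ^ M ≤ ρ ^ (w.length - N) := pow_le_pow_right₀ hρ.le (by omega)
      _ ≤ ‖flipWord a (i :: w) i‖ := h.pow_le_norm hn hρ hr (by omega)
      _ ≤ ‖flipWord a (i :: w)‖ := norm_le_pi_norm _ i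

end ExpandsFrom

/-! ### Alternating words -/

section Alternate

variable {α : Type*} {i j k : α}

/-- The `m`-th term of the sequence `i, j, i, j, …`. -/
def letter (i j : α) (m : ℕ) : α := if Even m then i else j

theorem letter_add_two (i j : α) (m : ℕ) : letter i j (m + 2) = letter i j m := by
  simp [letter, Nat.even_add]

theorem letter_eq_or (i j : α) (m : ℕ) :
    letter i j m = i ∧ letter i j (m + 1) = j ∨ letter i j m = j ∧ letter i j (m + 1) = i := by
  by_cases h : Even m <;> simp [letter, h, Nat.even_add_one]

theorem letter_succ_ne (hij : i ≠ j) (m : ℕ) : letter i j (m + 1) ≠ letter i j m := by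
  rcases letter_eq_or i j m with ⟨h, h'⟩ | ⟨h, h'⟩ <;> rw [h, h']
  exacts [hij.symm, hij]

theorem ne_letter (hi : k ≠ i) (hj : k ≠ j) (m : ℕ) : k ≠ letter i j m := by
  rcases letter_eq_or i j m with ⟨h, -⟩ | ⟨h, -⟩ <;> rw [h] <;> assumption

theorem eq_letter_succ (hk : k = i ∨ k = j) {m : ℕ} (h : k ≠ letter i j m) :
    k = letter i j (m + 1) := by
  rcases letter_eq_or i j m with ⟨h₀, h₁⟩ | ⟨h₀, h₁⟩ <;> rw [h₁] <;> rw [h₀] at h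
  exacts [hk.resolve_left h, hk.resolve_right h]

/-- The word `u` with `m` letters `…, i, j, i` put in front, starting with `i`; these are the
vertices on one half of an alternating geodesic. -/
def alternate (i j : α) (u : List α) : ℕ → List α
  | 0 => u
  | m + 1 => letter i j m :: alternate i j u m

theorem length_alternate (i j : α) (u : List α) (m : ℕ) :
    (alternate i j u m).length = u.length + m := by
  induction m with
  | zero => rfl
  | succ m ih => rw [alternate, List.length_cons, ih, add_assoc]

theorem reduced_alternate {u : List α} (hij : i ≠ j) (hu : Reduced (i :: u)) (m : ℕ) :
    Reduced (alternate i j u (m + 1)) := by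
  induction m with
  | zero => simpa [alternate, letter] using hu
  | succ m ih => exact List.isChain_cons_cons.mpr ⟨letter_succ_ne hij m, ih⟩

theorem exists_eq_alternate_dropWhile [DecidableEq α] (i j : α) {w : List α} (hw : Reduced w) :
    ∃ m, w = alternate i j (w.dropWhile (· ∈ ({i, j} : Finset α))) m ∨
      w = alternate j i (w.dropWhile (· ∈ ({i, j} : Finset α))) m := by
  induction w with
  | nil => exact ⟨0, Or.inl rfl⟩
  | cons k t ih =>
    by_cases hk : k ∈ ({i, j} : Finset α)
    · rw [List.dropWhile_cons_of_pos (by simpa using hk)]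
      generalize t.dropWhile _ = u at ih ⊢
      have hk' : k = i ∨ k = j := by simpa using hk
      obtain ⟨m, h⟩ := ih hw.tail
      cases m with
      | zero =>
        have ht : t = u := by simpa [alternate] using h
        refine ⟨1, hk'.imp ?_ ?_⟩ <;> rintro rfl <;> simp [alternate, letter, ht]
      | succ m =>
        refine ⟨m + 2, h.imp ?_ ?_⟩ <;> rintro rfl
        · rw [alternate, eq_letter_succ hk' (List.isChain_cons_cons.mp hw).1]; rfl
        · rw [alternate, eq_letter_succ hk'.symm (List.isChain_cons_cons.mp hw).1]; rfl
    · rw [List.dropWhile_cons_of_neg (by simpa using hk)]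
      exact ⟨0, Or.inl rfl⟩

end Alternate

section AlternateFlips

variable {n : ℕ} {a : Fin n → ℂ} {i j k : Fin n} {u : List (Fin n)}

theorem flipWord_alternate_of_ne (hki : k ≠ i) (hkj : k ≠ j) (m : ℕ) :
    flipWord a (alternate i j u m) k = flipWord a u k := by
  induction m with
  | zero => rfl
  | succ m ih => rw [alternate, flipWord_cons, flipMap_of_ne _ (ne_letter hki hkj m), ih]

theorem prodErasePair_letter_flipWord_alternate (m m' : ℕ) :
    prodErasePair (flipWord a (alternate i j u m)) (letter i j m') (letter i j (m' + 1)) =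
      prodErasePair (flipWord a u) i j := by
  trans prodErasePair (flipWord a (alternate i j u m)) i j
  · rcases letter_eq_or i j m' with ⟨h, h'⟩ | ⟨h, h'⟩ <;> rw [h, h']
    rw [prodErasePair_comm]
  · exact prodErasePair_congr fun _ hi hj => flipWord_alternate_of_ne hi hj m

variable {l A B : ℂ}

theorem flipWord_alternate_letter (hij : i ≠ j) (hl : l ≠ 0)
    (hc : l + l⁻¹ = prodErasePair (flipWord a u) i j) (hi : binet l A B 0 = flipWord a u i)
    (hj : binet l A B 1 = flipWord a u j) (m : ℕ) :
    flipWord a (alternate i j u m) (letter i j m) = binet l A B m ∧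
      flipWord a (alternate i j u m) (letter i j (m + 1)) = binet l A B (m + 1) := by
  induction m with
  | zero => simp [alternate, letter, hi, hj]
  | succ m ih =>
    rw [alternate, flipWord_cons]
    constructor
    · rw [flipMap_of_ne _ (letter_succ_ne hij m), ih.2]
    · rw [letter_add_two, flipMap_self, prodErase_eq_prodErasePair_mul _ (letter_succ_ne hij m),
        prodErasePair_letter_flipWord_alternate, ih.1, ih.2, binet_add_two hl, hc]

/-- If the coordinates decayed along an alternating geodesic, then infinitely many of the
alternating geodesics which meet it would be small. -/
theorem binet_coeff_ne_zero (hn : 3 ≤ n) {K : ℝ} (hK : 0 < K)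
    (hF : {γ : AltGeodesic n | ‖extHurwitz a γ‖ ≤ K}.Finite) (hij : i ≠ j)
    (hu : Reduced (i :: u)) (hl : 1 < ‖l‖) (hc : l + l⁻¹ = prodErasePair (flipWord a u) i j)
    (hi : binet l A B 0 = flipWord a u i) (hj : binet l A B 1 = flipWord a u j) : A ≠ 0 := by
  rintro rfl
  obtain ⟨k, hki, hkj⟩ := Fin.exists_ne_and_ne_of_two_lt i j hn
  let γ (m : ℕ) : AltGeodesic n :=
    geodesic (alternate i j u (m + 1)) (ne_letter hki hkj (m + 1))
  have hroot (m : ℕ) : root (γ m) = alternate i j u (m + 1) := by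
    rw [root_geodesic (reduced_alternate hij hu m), alternate, List.dropWhile_cons_of_neg]
    simp [(ne_letter hki hkj m).symm, (letter_succ_ne hij m).symm]
  have hinj : Function.Injective γ := fun m m' h => by
    have := congrArg (fun γ => (root γ).length) h
    simpa [hroot, length_alternate] using this
  have hval (m : ℕ) : extHurwitz a (γ m) =
      binet l 0 B (m + 2) * ∏ q ∈ ({i, j, k} : Finset (Fin n))ᶜ, flipWord a u q := by
    have hset : ({k, letter i j (m + 1), letter i j m} : Finset (Fin n)) = {i, j, k} := by
      rcases letter_eq_or i j m with ⟨h, h'⟩ | ⟨h, h'⟩ <;> rw [h, h'] <;> ext <;> simp <;> tauto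
    rw [extHurwitz_geodesic, prodErasePair_eq_mul_prod _ (ne_letter hki hkj m).symm
      (letter_succ_ne hij m).symm, hset, ← letter_add_two,
      (flipWord_alternate_letter hij (norm_pos_iff.mp (one_pos.trans hl)) hc hi hj (m + 1)).2]
    congr 1
    refine Finset.prod_congr rfl fun q hq => ?_
    simp only [Finset.mem_compl, Finset.mem_insert, Finset.mem_singleton, not_or] at hq
    exact flipWord_alternate_of_ne hq.1 hq.2.1 _
  have hlim : Filter.Tendsto (fun m => ‖extHurwitz a (γ m)‖) Filter.atTop (nhds 0) := by
    simpa only [hval, zero_mul, norm_zero, Function.comp_apply] using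
      (((Filter.tendsto_add_atTop_iff_nat 2).mpr (tendsto_binet_zero (B := B) hl)).mul_const _).norm
  have hnotMem : ∀ᶠ m in Filter.atTop, γ m ∉ {γ : AltGeodesic n | ‖extHurwitz a γ‖ ≤ K} :=
    (Nat.cofinite_eq_atTop ▸ hinj.tendsto_cofinite).eventually hF.eventually_cofinite_notMem
  obtain ⟨m, hm, hm'⟩ := (hnotMem.and (hlim.eventually_le_const hK)).exists
  exact hm hm'

theorem tendsto_norm_flipWord_alternate (hij : i ≠ j) (hl : 1 < ‖l‖) (hA : A ≠ 0)
    (hc : l + l⁻¹ = prodErasePair (flipWord a u) i j) (hi : binet l A B 0 = flipWord a u i)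
    (hj : binet l A B 1 = flipWord a u j) (hk : k = i ∨ k = j) :
    Filter.Tendsto (fun m => ‖flipWord a (alternate i j u m) k‖) Filter.atTop Filter.atTop := by
  have hlim := tendsto_norm_binet_atTop (B := B) hl hA
  refine Filter.tendsto_atTop.mpr fun C => ?_
  filter_upwards [hlim.eventually_ge_atTop C,
    ((Filter.tendsto_add_atTop_iff_nat 1).mpr hlim).eventually_ge_atTop C] with m hm hm'
  have hval := flipWord_alternate_letter hij (norm_pos_iff.mp (one_pos.trans hl)) hc hi hj m
  by_cases h : k = letter i j m
  · rwa [h, hval.1]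
  · rwa [eq_letter_succ hk h, hval.2]

theorem tendsto_prod_atTop {ι β : Type*} {F : Filter β} {f : ι → β → ℝ} {s : Finset ι} {p : ι}
    (hp : p ∈ s) (hfp : Filter.Tendsto (f p) F Filter.atTop)
    (h : ∀ q ∈ s, ∃ d > 0, ∀ᶠ b in F, d ≤ f q b) :
    Filter.Tendsto (fun b => ∏ q ∈ s, f q b) F Filter.atTop := by
  classical
  choose! d hd hdf using h
  have hpos : 0 < ∏ q ∈ s.erase p, d q :=
    Finset.prod_pos fun q hq => hd q (Finset.mem_of_mem_erase hq)
  refine Filter.tendsto_atTop_mono' F ?_ (hfp.atTop_mul_const hpos)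
  filter_upwards [(Filter.eventually_all_finset s).mpr hdf, hfp.eventually_ge_atTop 0] with b hb hb'
  rw [← Finset.mul_prod_erase s _ hp]
  exact mul_le_mul_of_nonneg_left (Finset.prod_le_prod
    (fun q hq => (hd q (Finset.mem_of_mem_erase hq)).le)
    fun q hq => hb q (Finset.mem_of_mem_erase hq)) hb'

theorem eventually_recessive_alternate (hij : i ≠ j) (ρ : ℝ)
    (hc : prodErasePair (flipWord a u) i j ≠ 0)
    (hlim : ∀ p, p = i ∨ p = j →
      Filter.Tendsto (fun m => ‖flipWord a (alternate i j u m) p‖) Filter.atTop Filter.atTop) :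
    ∀ᶠ m in Filter.atTop, ∀ k, k ≠ i → k ≠ j → Recessive ρ (flipWord a (alternate i j u m)) k := by
  have hbound (q : Fin n) :
      ∃ d > 0, ∀ᶠ m in Filter.atTop, d ≤ ‖flipWord a (alternate i j u m) q‖ := by
    by_cases hq : q = i ∨ q = j
    · exact ⟨1, one_pos, (hlim q hq).eventually_ge_atTop 1⟩
    · rw [not_or] at hq
      refine ⟨‖flipWord a u q‖, norm_pos_iff.mpr ?_, Filter.Eventually.of_forall fun m => ?_⟩
      · exact Finset.prod_ne_zero_iff.mp hc q (by simp [hq])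
      · rw [flipWord_alternate_of_ne hq.1 hq.2]
  have hprod {s : Finset (Fin n)} {p : Fin n} (hp : p = i ∨ p = j) (hps : p ∈ s) (C : ℝ) :
      ∀ᶠ m in Filter.atTop, C < ‖∏ q ∈ s, flipWord a (alternate i j u m) q‖ := by
    simp only [norm_prod]
    exact (tendsto_prod_atTop hps (hlim p hp) fun q _ => hbound q).eventually_gt_atTop C
  refine Filter.eventually_all.mpr fun k => Filter.eventually_all.mpr fun hki =>
    Filter.eventually_all.mpr fun hkj => Filter.Eventually.and ?_ ?_
  · simpa only [prodErase, flipWord_alternate_of_ne hki hkj] using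
      hprod (Or.inl rfl) (Finset.mem_erase.mpr ⟨hki.symm, Finset.mem_univ i⟩) _
  · refine Filter.eventually_all.mpr fun q => Filter.eventually_all.mpr fun _ => ?_
    by_cases hq : i = q
    · exact hprod (Or.inr rfl) (by simp [hkj.symm, ← hq, hij.symm]) _
    · exact hprod (Or.inl rfl) (by simp [hki.symm, hq]) _

theorem eventually_expanding_alternate (hn : 3 ≤ n) {K ρ : ℝ} (hK : 0 < K) (hρ : 1 ≤ ρ)
    (hF : {γ : AltGeodesic n | ‖extHurwitz a γ‖ ≤ K}.Finite) (hij : i ≠ j)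
    (hu : Reduced (i :: u)) (hl : ρ < ‖l‖) (hc : l + l⁻¹ = prodErasePair (flipWord a u) i j)
    (hc0 : prodErasePair (flipWord a u) i j ≠ 0) :
    ∀ᶠ m in Filter.atTop,
      Expanding ρ (flipWord a (alternate i j u (m + 1))) (letter i j m) := by
  have hl1 : 1 < ‖l‖ := hρ.trans_lt hl
  obtain ⟨A, B, hi, hj⟩ := exists_binet_eq hl1 (flipWord a u i) (flipWord a u j)
  have hA : A ≠ 0 := binet_coeff_ne_zero hn hK hF hij hu hl1 hc hi hj
  have hrec := eventually_recessive_alternate hij ρ hc0 fun p =>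
    tendsto_norm_flipWord_alternate hij hl1 hA hc hi hj
  have hlarge := (tendsto_norm_binet_atTop (B := B) hl1 hA).eventually_gt_atTop 1
  have hcone := eventually_inCone_binet (B := B) hρ hl hA
  filter_upwards [(Filter.tendsto_add_atTop_nat 1).eventually (hrec.and (hlarge.and hcone))]
    with m ⟨hrec, hlarge, hcone⟩
  have hval :=
    flipWord_alternate_letter hij (norm_pos_iff.mp (one_pos.trans hl1)) hc hi hj (m + 1)
  rw [letter_add_two] at hval
  refine Or.inr ⟨letter i j (m + 1), letter_succ_ne hij m, ?_, ?_, fun k hk hk' => ?_⟩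
  · rwa [hval.1]
  · rwa [hval.1, hval.2, prodErasePair_letter_flipWord_alternate, ← hc]
  · rcases letter_eq_or i j m with ⟨h, h'⟩ | ⟨h, h'⟩ <;> rw [h] at hk <;> rw [h'] at hk'
    exacts [hrec k hk hk', hrec k hk' hk]

end AlternateFlips

/-! ### Points of the domain expand -/

section Domain

variable {n : ℕ} {a x : Fin n → ℂ} {i j : Fin n} {ρ : ℝ}

theorem exists_ratio (ha : a ∈ bowditchDomain n) :
    ∃ ρ : ℝ, 1 < ρ ∧ {γ : AltGeodesic n | ‖extHurwitz a γ‖ ≤ 2 * ρ}.Finite ∧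
      ∀ γ : AltGeodesic n, ‖extHurwitz a γ‖ ≤ 2 * ρ →
        ∃ l : ℂ, ρ < ‖l‖ ∧ l + l⁻¹ = extHurwitz a γ := by
  obtain ⟨hcut, K, hK, hF⟩ := ha
  choose l hl hc using fun γ => exists_add_inv_eq (hcut γ)
  have hlt {b : ℝ} (hb : 1 < b) : ∀ᶠ ρ in nhdsWithin (1 : ℝ) (Set.Ioi 1), ρ < b :=
    mem_nhdsWithin_of_mem_nhds (Iio_mem_nhds hb)
  have hall : ∀ᶠ ρ in nhdsWithin (1 : ℝ) (Set.Ioi 1),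
      ∀ γ ∈ {γ : AltGeodesic n | ‖extHurwitz a γ‖ ≤ K}, ρ < ‖l γ‖ :=
    (Filter.eventually_all_finite hF).mpr fun γ _ => hlt (hl γ)
  obtain ⟨ρ, hρ, hρK, hρl⟩ :=
    (eventually_mem_nhdsWithin.and ((hlt (by linarith : 1 < K / 2)).and hall)).exists
  have hle : 2 * ρ ≤ K := by linarith
  exact ⟨ρ, hρ, hF.subset fun γ hγ => le_trans hγ hle,
    fun γ hγ => ⟨l γ, hρl γ (le_trans hγ hle), hc γ⟩⟩

theorem eventually_expanding_of_geodesic_eq (hn : 3 ≤ n) (hρ : 1 < ρ)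
    (hF : {γ : AltGeodesic n | ‖extHurwitz a γ‖ ≤ 2 * ρ}.Finite) {γ : AltGeodesic n}
    (hγ : extHurwitz a γ ≠ 0) {l : ℂ} (hl : ρ < ‖l‖) (hc : l + l⁻¹ = extHurwitz a γ) :
    ∀ᶠ N in Filter.atTop, ∀ i w, Reduced (i :: w) → w.length = N → ∀ j (h : i ≠ j),
      geodesic (i :: w) h = γ → Expanding ρ (flipWord a (i :: w)) i := by
  obtain ⟨p, q, hpq, hroot⟩ := exists_geodesic_root_eq γ
  have hval : extHurwitz a γ = prodErasePair (flipWord a (root γ)) p q := by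
    rw [← extHurwitz_geodesic a _ hpq, hroot]
  have hred {r : Fin n} (hr : r ∈ ({p, q} : Finset (Fin n))) : Reduced (r :: root γ) :=
    reduced_cons_root (hroot ▸ hr)
  have hevent {r s : Fin n} (hrs : r ≠ s) (hr : r ∈ ({p, q} : Finset (Fin n)))
      (h : extHurwitz a γ = prodErasePair (flipWord a (root γ)) r s) :=
    eventually_expanding_alternate hn (by linarith) hρ.le hF hrs (hred hr) hl (hc.trans h) (h ▸ hγ)
  filter_upwards [(Filter.tendsto_sub_atTop_nat (root γ).length).eventually
      ((hevent hpq (by simp) hval).and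
        (hevent hpq.symm (by simp) (hval.trans (prodErasePair_comm _ _ _)))),
    Filter.eventually_ge_atTop (root γ).length] with N hN hle i w hr hw j hij hgeod
  have hset : ({p, q} : Finset (Fin n)) = {i, j} :=
    congrArg (fun γ : AltGeodesic n => γ.1.1) (hroot.trans hgeod.symm)
  obtain ⟨m, hm⟩ := exists_eq_alternate_dropWhile p q hr
  rw [hset, ← root_geodesic hr hij, hgeod] at hm
  obtain rfl : m = N - (root γ).length + 1 := by
    have : w.length + 1 = (root γ).length + m := by
      rcases hm with h | h <;> simpa [length_alternate] using congrArg List.length h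
    omega
  rcases hm with h | h <;> obtain rfl := (List.cons_eq_cons.mp h).1 <;> rw [h]
  exacts [hN.1, hN.2]

theorem pow_mul_norm_prodErase_le (hρ : 1 ≤ ρ) {w : List (Fin n)} (hr : Reduced (i :: w))
    (hlarge : LargeAt (2 * ρ) (flipWord a (i :: w)) i)
    (hx : 2 * ‖flipWord a (i :: w) i‖ ≤ ‖prodErase (flipWord a (i :: w)) i‖) :
    ρ ^ w.length * ‖prodErase (flipWord a (i :: w)) i‖ ≤ ∑ k, ‖prodErase a k‖ := by
  induction w generalizing i with
  | nil =>
    rw [flipWord_cons, prodErase_flipMap, List.length_nil, pow_zero, one_mul]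
    exact Finset.single_le_sum (f := fun k => ‖prodErase a k‖) (fun _ _ => norm_nonneg _)
      (Finset.mem_univ i)
  | cons j w ih =>
    rw [flipWord_cons] at hlarge hx ⊢
    set y := flipWord a (j :: w)
    have hij := (List.isChain_cons_cons.mp hr).1
    have hlarge : LargeAt (2 * ρ) y i := fun k hk => by
      simpa only [prodErasePair_flipMap] using hlarge k hk
    rw [prodErase_flipMap, flipMap_self] at hx
    rw [prodErase_flipMap]
    have hyi : ‖prodErase y i‖ ≤ 2 * ‖y i‖ := by
      linarith [norm_sub_norm_le (prodErase y i) (y i)]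
    have hyj : ‖y j‖ ≤ ‖y i‖ := (le_mul_of_one_le_left (norm_nonneg _) hρ).trans
      (hlarge.mul_norm_le hyi hij.symm)
    have hgrow := hlarge.mul_norm_le_norm_prodErase hij.symm
    have hstep : 2 * ‖y j‖ ≤ ‖prodErase y j‖ := by
      nlinarith [norm_nonneg (y i)]
    refine le_trans ?_ (ih hr.tail (hlarge.of_norm_le hyj hij.symm) hstep)
    rw [List.length_cons, pow_succ, mul_assoc]
    gcongr
    calc ρ * ‖prodErase y i‖ ≤ ρ * (2 * ‖y i‖) := by gcongr
      _ = 2 * ρ * ‖y i‖ := by ring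
      _ ≤ ‖prodErase y j‖ := hgrow

theorem exists_expandsFrom (hn : 3 ≤ n) (ha : a ∈ bowditchDomain n) :
    ∃ ρ N, 1 < ρ ∧ ExpandsFrom ρ N a := by
  obtain ⟨ρ, hρ, hF, hratio⟩ := exists_ratio ha
  have hsmall : ∀ᶠ N in Filter.atTop, ∀ γ ∈ {γ : AltGeodesic n | ‖extHurwitz a γ‖ ≤ 2 * ρ},
      ∀ i w, Reduced (i :: w) → w.length = N → ∀ j (h : i ≠ j),
        geodesic (i :: w) h = γ → Expanding ρ (flipWord a (i :: w)) i := by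
    refine (Filter.eventually_all_finite hF).mpr fun γ hγ => ?_
    obtain ⟨l, hl, hc⟩ := hratio γ hγ
    refine eventually_expanding_of_geodesic_eq hn hρ hF (fun h0 => ha.1 γ ?_) hl hc
    exact h0 ▸ zero_mem_cutInterval
  obtain ⟨N, hN, hpow⟩ := (hsmall.and ((tendsto_pow_atTop_atTop_of_one_lt hρ).eventually_gt_atTop
    (∑ k, ‖prodErase a k‖))).exists
  refine ⟨ρ, N, hρ, fun i w hr hw => ?_⟩
  by_cases hlarge : LargeAt (2 * ρ) (flipWord a (i :: w)) i
  · refine Or.inl ⟨?_, hlarge⟩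
    by_contra! hx
    have hgrow := pow_mul_norm_prodErase_le hρ.le hr hlarge hx
    have hone : 1 ≤ ‖prodErase (flipWord a (i :: w)) i‖ := by
      linarith [hlarge.lt_norm_prodErase (by omega) (by linarith)]
    rw [hw] at hgrow
    exact hpow.not_ge ((le_mul_of_one_le_right (by positivity) hone).trans hgrow)
  · simp only [LargeAt, not_forall, not_lt] at hlarge
    obtain ⟨j, hj, hle⟩ := hlarge
    refine hN (geodesic (i :: w) hj.symm) ?_ i w hr hw j hj.symm rfl
    rwa [Set.mem_ofPred_eq, extHurwitz_geodesic]

theorem isOpen_bowditchDomain (hn : 3 ≤ n) : IsOpen (bowditchDomain n) := by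
  refine isOpen_iff_mem_nhds.mpr fun a ha => ?_
  obtain ⟨ρ, N, hρ, hexp⟩ := exists_expandsFrom hn ha
  filter_upwards [(isOpen_setOf_expandsFrom hρ.le N).mem_nhds hexp,
    (isOpen_setOf_forall_notMem_cutInterval N).mem_nhds fun l _ i j hij =>
      extHurwitz_geodesic a l hij ▸ ha.1 (geodesic l hij)] with b hb hshort
  exact hb.mem_bowditchDomain hρ hshort

/-! ### The action on the domain -/

theorem finite_setOf_norm_vecHurwitz_le (hn : 3 ≤ n) {C : Set (Fin n → ℂ)}
    (hC : C ⊆ bowditchDomain n) (hcomp : IsCompact C) (R : ℝ) :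
    {g : Gam n | ∃ b ∈ C, ‖vecHurwitz b g‖ ≤ R}.Finite := by
  refine hcomp.induction_on (p := fun S => {g : Gam n | ∃ b ∈ S, ‖vecHurwitz b g‖ ≤ R}.Finite)
    (by simp) (fun S T hST hT => hT.subset fun g ⟨b, hb, hg⟩ => ⟨b, hST hb, hg⟩)
    (fun S T hS hT => (hS.union hT).subset ?_) fun a ha => ?_
  · rintro g ⟨b, hb | hb, hg⟩
    exacts [Or.inl ⟨b, hb, hg⟩, Or.inr ⟨b, hb, hg⟩]
  · obtain ⟨ρ, N, hρ, hexp⟩ := exists_expandsFrom hn (hC ha)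
    obtain ⟨M, hM⟩ := pow_unbounded_of_one_lt R hρ
    refine ⟨_, mem_nhdsWithin_of_mem_nhds ((isOpen_setOf_expandsFrom hρ.le N).mem_nhds hexp),
      ((List.finite_length_le (Fin n) (N + M)).image eval).subset ?_⟩
    rintro g ⟨b, hb, hg⟩
    exact ⟨normalForm g, ExpandsFrom.length_normalForm_le (by omega) hρ hb hM hg,
      eval_normalForm g⟩

theorem finite_setOf_inter_nonempty (hn : 3 ≤ n) {C : Set (Fin n → ℂ)}
    (hC : C ⊆ bowditchDomain n) (hcomp : IsCompact C) :
    {g : Gam n | ((fun x : Fin n → ℂ => g • x) '' C ∩ C).Nonempty}.Finite := by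
  obtain ⟨R, hR⟩ := hcomp.isBounded.exists_norm_le
  refine ((finite_setOf_norm_vecHurwitz_le hn hC hcomp R).image (·⁻¹)).subset ?_
  rintro g ⟨_, ⟨c, hc, rfl⟩, hgc⟩
  exact ⟨g⁻¹, ⟨c, hc, by simpa [vecHurwitz] using hR _ hgc⟩, inv_inv g⟩

/-- Left translation by `h` as an endomorphism of the Cayley graph which preserves the labels. -/
def translateHom (h : Gam n) (I : Finset (Fin n)) :
    labelGraph (n := n) I →g labelGraph (n := n) I where
  toFun g := h * g
  map_rel' := by
    rintro x y ⟨hne, i, hi, hxy⟩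
    exact ⟨fun he => hne (mul_left_cancel he), i, hi, by rw [hxy, mul_assoc]⟩

/-- Left translation by `h` on the alternating geodesics. -/
def translate (h : Gam n) (γ : AltGeodesic n) : AltGeodesic n :=
  ⟨γ.1, γ.2.map (translateHom h γ.1.1)⟩

theorem translate_injective (h : Gam n) : Function.Injective (translate h) := by
  refine Function.LeftInverse.injective (g := translate h⁻¹) ?_
  rintro ⟨I, c⟩
  induction c using SimpleGraph.ConnectedComponent.ind with
  | h g =>
    exact congrArg (fun v => (⟨I, (labelGraph I.1).connectedComponentMk v⟩ : AltGeodesic n))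
      (inv_mul_cancel_left h g)

theorem extHurwitz_smul (h : Gam n) (a : Fin n → ℂ) (γ : AltGeodesic n) :
    extHurwitz (h • a) γ = extHurwitz a (translate h⁻¹ γ) := by
  obtain ⟨I, c⟩ := γ
  induction c using SimpleGraph.ConnectedComponent.ind with
  | h g =>
    simp only [translate, translateHom, SimpleGraph.ConnectedComponent.map_mk, extHurwitz_mk]
    refine Finset.prod_congr rfl fun k _ => congrFun ?_ k
    simp [vecHurwitz, mul_smul]

theorem smul_mem_bowditchDomain (h : Gam n) (ha : a ∈ bowditchDomain n) :
    h • a ∈ bowditchDomain n := by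
  obtain ⟨hcut, K, hK, hF⟩ := ha
  refine ⟨fun γ => ?_, K, hK, ?_⟩
  · rw [extHurwitz_smul]
    exact hcut _
  · simp only [extHurwitz_smul]
    exact hF.preimage (translate_injective h⁻¹).injOn

theorem image_smul_bowditchDomain (h : Gam n) :
    (fun x : Fin n → ℂ => h • x) '' bowditchDomain n = bowditchDomain n := by
  refine Set.Subset.antisymm ?_ fun a ha => ⟨h⁻¹ • a, smul_mem_bowditchDomain h⁻¹ ha, ?_⟩
  · rintro _ ⟨a, ha, rfl⟩
    exact smul_mem_bowditchDomain h ha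
  · exact smul_inv_smul h a

end Domain

/-! ### Nearly cancelling sums of squares -/

section Estimates

/-- With `c = l + l⁻¹`, the left side is within `O(‖c‖)` of `‖P + Q‖ ^ 2 + ‖P - Q‖ ^ 2`. -/
theorem norm_sq_add_norm_sq_le {l P Q : ℂ} {κ : ℝ} (hl : 1 < ‖l‖) (hκ : ‖l + l⁻¹‖ ≤ κ)
    (hκ1 : κ ≤ 1) (hQP : ‖Q‖ ≤ ‖P‖) (hPQ : ‖P‖ ≤ ‖l‖ ^ 2 * ‖Q‖) :
    ‖P + Q‖ ^ 2 + ‖P * l + Q * l⁻¹‖ ^ 2 ≤ (1 + 10 * κ) * ‖P * Q * (4 - (l + l⁻¹) ^ 2)‖ := by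
  have hκ0 : 0 ≤ κ := (norm_nonneg _).trans hκ
  have hinv : ‖l⁻¹‖ ≤ 1 := (norm_inv l).trans_le (inv_le_one_of_one_le₀ hl.le)
  have hL : ‖l‖ ^ 2 ≤ 1 + 3 * κ := by
    have := norm_sub_le (l + l⁻¹) l⁻¹
    rw [add_sub_cancel_right] at this
    nlinarith [norm_nonneg l]
  have hP : ‖P‖ ^ 2 ≤ (1 + 3 * κ) * (‖P‖ * ‖Q‖) := by
    calc ‖P‖ ^ 2 ≤ ‖P‖ * (‖l‖ ^ 2 * ‖Q‖) := by rw [sq]; gcongr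
      _ = ‖l‖ ^ 2 * (‖P‖ * ‖Q‖) := by ring
      _ ≤ _ := by gcongr
  have hQ : ‖Q‖ ^ 2 ≤ ‖P‖ * ‖Q‖ := by rw [sq]; gcongr
  have hPκ : κ * ‖P‖ ^ 2 ≤ 4 * κ * (‖P‖ * ‖Q‖) := by
    nlinarith [mul_nonneg hκ0 (mul_nonneg (norm_nonneg P) (norm_nonneg Q))]
  have hnext : ‖P * l + Q * l⁻¹‖ ≤ ‖P - Q‖ + κ * ‖P‖ := by
    have h : P * l + Q * l⁻¹ = (l + l⁻¹) * P - (P - Q) * l⁻¹ := by ring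
    rw [h, add_comm ‖P - Q‖]
    refine (norm_sub_le _ _).trans (add_le_add ?_ ?_) <;> rw [norm_mul]
    · gcongr
    · exact mul_le_of_le_one_right (norm_nonneg _) hinv
  have hnextSq : ‖P * l + Q * l⁻¹‖ ^ 2 ≤ ‖P - Q‖ ^ 2 + 5 * (κ * ‖P‖ ^ 2) := by
    have hsub : ‖P - Q‖ ≤ 2 * ‖P‖ := by linarith [norm_sub_le P Q]
    calc ‖P * l + Q * l⁻¹‖ ^ 2 ≤ (‖P - Q‖ + κ * ‖P‖) ^ 2 := by gcongr
      _ = ‖P - Q‖ ^ 2 + 2 * (κ * ‖P‖) * ‖P - Q‖ + κ * (κ * ‖P‖ ^ 2) := by ring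
      _ ≤ ‖P - Q‖ ^ 2 + 2 * (κ * ‖P‖) * (2 * ‖P‖) + 1 * (κ * ‖P‖ ^ 2) := by gcongr
      _ = _ := by ring
  have hrhs : (4 - κ) * (‖P‖ * ‖Q‖) ≤ ‖P * Q * (4 - (l + l⁻¹) ^ 2)‖ := by
    rw [norm_mul, norm_mul, mul_comm]
    gcongr
    have h := norm_sub_norm_le (4 : ℂ) ((l + l⁻¹) ^ 2)
    rw [norm_pow, Complex.norm_ofNat] at h
    nlinarith [norm_nonneg (l + l⁻¹)]
  have hpar := parallelogram_law_with_norm ℝ P Q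
  calc ‖P + Q‖ ^ 2 + ‖P * l + Q * l⁻¹‖ ^ 2
      ≤ (4 + 26 * κ) * (‖P‖ * ‖Q‖) := by linarith
    _ ≤ (1 + 10 * κ) * (4 - κ) * (‖P‖ * ‖Q‖) := by gcongr; nlinarith
    _ ≤ _ := by rw [mul_assoc]; gcongr

theorem binet_quadratic {l A B : ℂ} (hl : l ≠ 0) :
    binet l A B 0 ^ 2 + binet l A B 1 ^ 2 - (l + l⁻¹) * binet l A B 0 * binet l A B 1 =
      A * B * (4 - (l + l⁻¹) ^ 2) := by
  simp only [binet, pow_zero, pow_one]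
  field_simp
  ring

/-- Near the minimum of the sequence two consecutive terms are nearly as small as the invariant
quadratic form allows. -/
theorem exists_norm_sq_binet_le {l A B : ℂ} {κ θ : ℝ} (hl : 1 < ‖l‖) (hκ : ‖l + l⁻¹‖ ≤ κ)
    (hκ1 : κ ≤ 1) (hθ : 0 < θ) (hAB : ‖A‖ ≤ ‖B‖) :
    ∃ m, ‖binet l A B (m + 1)‖ ^ 2 + ‖binet l A B (m + 2)‖ ^ 2 ≤
      (1 + 10 * κ) * ‖A * B * (4 - (l + l⁻¹) ^ 2)‖ + θ := by
  have hκ0 : 0 ≤ κ := (norm_nonneg _).trans hκ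
  have hl0 : 0 < ‖l‖ := one_pos.trans hl
  rcases eq_or_ne A 0 with rfl | hA
  · have hlim (k : ℕ) :
        Filter.Tendsto (fun m => ‖binet l 0 B (m + k)‖ ^ 2) Filter.atTop (nhds 0) := by
      simpa using (((Filter.tendsto_add_atTop_iff_nat k).mpr (tendsto_binet_zero hl)).norm.pow 2)
    obtain ⟨m, hm⟩ := (((hlim 1).add (hlim 2)).eventually_lt_const (u := θ) (by simpa)).exists
    exact ⟨m, hm.le.trans (le_add_of_nonneg_left (by positivity))⟩
  · have hA' : 0 < ‖A‖ := norm_pos_iff.mpr hA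
    obtain ⟨m, hle, hlt⟩ := exists_nat_pow_near ((one_le_div hA').mpr hAB)
      (one_lt_pow₀ hl two_ne_zero)
    rw [le_div_iff₀ hA'] at hle
    rw [div_lt_iff₀ hA'] at hlt
    refine ⟨m, (le_of_eq_of_le ?_ (norm_sq_add_norm_sq_le (P := A * l ^ (m + 1))
      (Q := B * l⁻¹ ^ (m + 1)) hl hκ hκ1 ?_ ?_)).trans (le_add_of_le_of_nonneg (le_of_eq ?_) hθ.le)⟩
    · simp only [binet, pow_succ, mul_assoc]
    · rw [norm_mul, norm_mul, norm_pow, norm_pow, norm_inv, inv_pow, ← div_eq_mul_inv,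
        div_le_iff₀ (by positivity)]
      calc ‖B‖ ≤ (‖l‖ ^ 2) ^ (m + 1) * ‖A‖ := hlt.le
        _ = ‖A‖ * ‖l‖ ^ (m + 1) * ‖l‖ ^ (m + 1) := by ring
    · rw [norm_mul, norm_mul, norm_pow, norm_pow, norm_inv, inv_pow, ← div_eq_mul_inv,
        ← mul_div_assoc, le_div_iff₀ (by positivity)]
      calc ‖A‖ * ‖l‖ ^ (m + 1) * ‖l‖ ^ (m + 1) = ‖l‖ ^ 2 * ((‖l‖ ^ 2) ^ m * ‖A‖) := by ring
        _ ≤ ‖l‖ ^ 2 * ‖B‖ := by gcongr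
    · rw [mul_mul_mul_comm, ← mul_pow, mul_inv_cancel₀ (norm_pos_iff.mp hl0), one_pow, mul_one]

theorem norm_add_le_of_inner_le {E : Type*} [NormedAddCommGroup E] [InnerProductSpace ℝ E]
    {y z : E} {ε : ℝ} (hε0 : 0 ≤ ε) (hε1 : ε ≤ 1) (hyz : ‖y‖ ≤ ‖z‖)
    (h : inner ℝ y z ≤ -(ε * ‖z‖ ^ 2)) : ‖y + z‖ ≤ ‖y‖ + ‖z‖ - ε / 2 * ‖z‖ := by
  have hy := norm_nonneg y
  have hz := norm_nonneg z
  refine (sq_le_sq₀ (norm_nonneg _) (by nlinarith)).mp ?_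
  rw [norm_add_sq_real]
  have : ε * ‖z‖ * ‖y‖ ≤ ε * ‖z‖ * ‖z‖ := by gcongr
  nlinarith [mul_nonneg hy hz, sq_nonneg (ε * ‖z‖)]

theorem exists_norm_add_le_of_norm_sum_le {ι E : Type*} [NormedAddCommGroup E]
    [InnerProductSpace ℝ E] {s : Finset ι} {z : ι → E} {p : ι} (hp : p ∈ s) (hz : z p ≠ 0)
    (hmax : ∀ q ∈ s, ‖z q‖ ≤ ‖z p‖) (hsum : ‖∑ q ∈ s, z q‖ ≤ ‖z p‖ / 2) :
    ∃ q ∈ s, q ≠ p ∧ ‖z q + z p‖ ≤ ‖z q‖ + ‖z p‖ - ‖z p‖ / (4 * s.card) := by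
  classical
  have hcard : (1 : ℝ) ≤ s.card := mod_cast Finset.card_pos.mpr ⟨p, hp⟩
  set ε : ℝ := 1 / (2 * s.card) with hε
  have hε0 : 0 < ε := by positivity
  have hεcard : s.card * ε = 1 / 2 := by rw [hε]; field_simp
  have hzp : 0 < ‖z p‖ := norm_pos_iff.mpr hz
  obtain ⟨q, hq, hqp, hinner⟩ : ∃ q ∈ s, q ≠ p ∧ inner ℝ (z q) (z p) ≤ -(ε * ‖z p‖ ^ 2) := by
    by_contra! h
    have hlow : ∑ q ∈ s.erase p, -(ε * ‖z p‖ ^ 2) ≤ ∑ q ∈ s.erase p, inner ℝ (z q) (z p) :=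
      Finset.sum_le_sum fun q hq =>
        (h q (Finset.mem_of_mem_erase hq) (Finset.ne_of_mem_erase hq)).le
    have hup : inner ℝ (∑ q ∈ s, z q) (z p) ≤ ‖z p‖ / 2 * ‖z p‖ :=
      (real_inner_le_norm _ _).trans (by gcongr)
    rw [sum_inner, ← Finset.add_sum_erase _ _ hp, real_inner_self_eq_norm_sq] at hup
    rw [Finset.sum_const, nsmul_eq_mul, Finset.card_erase_of_mem hp,
      Nat.cast_pred (Finset.card_pos.mpr ⟨p, hp⟩)] at hlow
    nlinarith [mul_pos hε0 (pow_pos hzp 2)]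
  refine ⟨q, hq, hqp, ?_⟩
  have h := norm_add_le_of_inner_le hε0.le (by nlinarith) (hmax q hq) hinner
  rwa [show ε / 2 * ‖z p‖ = ‖z p‖ / (4 * s.card) by rw [hε]; field_simp; ring] at h

end Estimates

/-! ### The energy of a point near the origin -/

section Energy

variable {n : ℕ} {x y a : Fin n → ℂ} {i j : Fin n} {u : List (Fin n)} {r : ℝ}

/-- The Markoff–Hurwitz polynomial, which is invariant under `Γ_n`. -/
def hurwitz (x : Fin n → ℂ) : ℂ := ∑ k, x k ^ 2 - ∏ k, x k

/-- The squared Euclidean norm of a point of `ℂⁿ`, whose own norm is the maximum norm. -/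
noncomputable def energy (x : Fin n → ℂ) : ℝ := ∑ k, ‖x k‖ ^ 2

theorem hurwitz_eq (x : Fin n → ℂ) (i : Fin n) :
    hurwitz x = ∑ k ∈ Finset.univ.erase i, x k ^ 2 + x i * (x i - prodErase x i) := by
  rw [hurwitz, ← mul_prodErase x i, ← Finset.sum_erase_add _ _ (Finset.mem_univ i)]
  ring

theorem hurwitz_flipMap (x : Fin n → ℂ) (i : Fin n) : hurwitz (flipMap i x) = hurwitz x := by
  have hsum : ∑ k ∈ Finset.univ.erase i, flipMap i x k ^ 2 =
      ∑ k ∈ Finset.univ.erase i, x k ^ 2 :=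
    Finset.sum_congr rfl fun k hk => by rw [flipMap_of_ne x (Finset.ne_of_mem_erase hk)]
  rw [hurwitz_eq _ i, hurwitz_eq x i, hsum, prodErase_flipMap, flipMap_self]
  ring

theorem hurwitz_flipWord (a : Fin n → ℂ) (w : List (Fin n)) :
    hurwitz (flipWord a w) = hurwitz a := by
  induction w with
  | nil => rfl
  | cons i w ih => rw [flipWord_cons, hurwitz_flipMap, ih]

theorem norm_le_of_energy_le (hr : 0 ≤ r) (h : energy x ≤ r ^ 2) (k : Fin n) : ‖x k‖ ≤ r :=
  (sq_le_sq₀ (norm_nonneg _) hr).mp <| le_trans (Finset.single_le_sum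
    (f := fun k => ‖x k‖ ^ 2) (fun _ _ => sq_nonneg _) (Finset.mem_univ k)) h

theorem norm_sq_add_norm_sq_le_energy (hij : i ≠ j) (x : Fin n → ℂ) :
    ‖x i‖ ^ 2 + ‖x j‖ ^ 2 ≤ energy x := by
  rw [← Finset.sum_pair hij (f := fun k => ‖x k‖ ^ 2)]
  exact Finset.sum_le_sum_of_subset_of_nonneg (Finset.subset_univ _) fun _ _ _ => sq_nonneg _

theorem energy_sub_energy (hij : i ≠ j) (h : ∀ k, k ≠ i → k ≠ j → y k = x k) :
    energy y - energy x = ‖y i‖ ^ 2 + ‖y j‖ ^ 2 - (‖x i‖ ^ 2 + ‖x j‖ ^ 2) := by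
  rw [energy, energy, ← Finset.sum_sub_distrib, ← Finset.sum_subset (Finset.subset_univ {i, j}),
    Finset.sum_pair hij]
  · ring
  · intro k _ hk
    simp only [Finset.mem_insert, Finset.mem_singleton, not_or] at hk
    rw [h k hk.1 hk.2, sub_self]

theorem norm_prod_le_pow {ι 𝕜 : Type*} [NormedField 𝕜] {x : ι → 𝕜} {s : Finset ι} {m : ℕ}
    (hr0 : 0 ≤ r) (hr1 : r ≤ 1) (hx : ∀ k, ‖x k‖ ≤ r) (hm : m ≤ s.card) :
    ‖∏ k ∈ s, x k‖ ≤ r ^ m :=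
  calc ‖∏ k ∈ s, x k‖ = ∏ k ∈ s, ‖x k‖ := norm_prod s x
    _ ≤ ∏ _k ∈ s, r := Finset.prod_le_prod (fun _ _ => norm_nonneg _) fun k _ => hx k
    _ = r ^ s.card := Finset.prod_const r
    _ ≤ r ^ m := pow_le_pow_of_le_one hr0 hr1 hm

theorem energy_flipMap_le (hn : 3 ≤ n) (hr0 : 0 ≤ r) (hr1 : r ≤ 1) (hx : ∀ k, ‖x k‖ ≤ r)
    (i : Fin n) : energy (flipMap i x) ≤ energy x + 3 * r ^ 3 := by
  have hsum : energy (flipMap i x) - energy x = ‖flipMap i x i‖ ^ 2 - ‖x i‖ ^ 2 := by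
    rw [energy, energy, ← Finset.sum_sub_distrib, Finset.sum_eq_single i]
    · intro k _ hk
      rw [flipMap_of_ne x hk, sub_self]
    · simp
  have hprod : ‖prodErase x i‖ ≤ r ^ 2 := norm_prod_le_pow hr0 hr1 hx (by simp; omega)
  have hflip : ‖flipMap i x i‖ ≤ r ^ 2 + ‖x i‖ := by
    rw [flipMap_self]
    exact (norm_sub_le _ _).trans (by gcongr)
  have hsq : ‖flipMap i x i‖ ^ 2 ≤ ‖x i‖ ^ 2 + 3 * r ^ 3 := by
    calc ‖flipMap i x i‖ ^ 2 ≤ (r ^ 2 + ‖x i‖) ^ 2 := by gcongr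
      _ = ‖x i‖ ^ 2 + (r * r ^ 3 + 2 * (r ^ 2 * ‖x i‖)) := by ring
      _ ≤ ‖x i‖ ^ 2 + (1 * r ^ 3 + 2 * (r ^ 2 * r)) := by gcongr; exact hx i
      _ = _ := by ring
  linarith

/-! ### Going on inside a small ball -/

variable {κ θ : ℝ}

theorem exists_alternate_norm_sq_le (hij : i ≠ j) {l A B : ℂ} (hl : 1 < ‖l‖)
    (hc : l + l⁻¹ = prodErasePair (flipWord a u) i j) (hi : binet l A B 0 = flipWord a u i)
    (hj : binet l A B 1 = flipWord a u j) (hκ : ‖prodErasePair (flipWord a u) i j‖ ≤ κ)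
    (hκ1 : κ ≤ 1) (hθ : 0 < θ) (hAB : ‖A‖ ≤ ‖B‖) :
    ∃ m, ‖flipWord a (alternate i j u (m + 1)) i‖ ^ 2 +
        ‖flipWord a (alternate i j u (m + 1)) j‖ ^ 2 ≤
      (1 + 10 * κ) * ‖flipWord a u i ^ 2 + flipWord a u j ^ 2 -
        prodErasePair (flipWord a u) i j * flipWord a u i * flipWord a u j‖ + θ := by
  have hl0 : l ≠ 0 := norm_pos_iff.mp (one_pos.trans hl)
  obtain ⟨m, hm⟩ := exists_norm_sq_binet_le hl (hc ▸ hκ) hκ1 hθ hAB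
  rw [← binet_quadratic hl0] at hm
  obtain ⟨h₀, h₁⟩ := flipWord_alternate_letter hij hl0 hc hi hj (m + 1)
  rw [← h₀, ← h₁, hc, hi, hj] at hm
  refine ⟨m, ?_⟩
  rcases letter_eq_or i j (m + 1) with ⟨h, h'⟩ | ⟨h, h'⟩ <;> rw [h, h'] at hm
  · exact hm
  · rwa [add_comm (‖_‖ ^ 2)]

theorem exists_longer_norm_sq_le (hij : i ≠ j) (hi : Reduced (i :: u)) (hj : Reduced (j :: u))
    (hcut : prodErasePair (flipWord a u) i j ∉ cutInterval)
    (hκ : ‖prodErasePair (flipWord a u) i j‖ ≤ κ) (hκ1 : κ ≤ 1) (hθ : 0 < θ) :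
    ∃ w, Reduced w ∧ u.length < w.length ∧
      (∀ k, k ≠ i → k ≠ j → flipWord a w k = flipWord a u k) ∧
      ‖flipWord a w i‖ ^ 2 + ‖flipWord a w j‖ ^ 2 ≤
        (1 + 10 * κ) * ‖flipWord a u i ^ 2 + flipWord a u j ^ 2 -
          prodErasePair (flipWord a u) i j * flipWord a u i * flipWord a u j‖ + θ := by
  obtain ⟨l, hl, hc⟩ := exists_add_inv_eq hcut
  have hl0 : l ≠ 0 := norm_pos_iff.mp (one_pos.trans hl)
  obtain ⟨A, B, h₀, h₁⟩ := exists_binet_eq hl (flipWord a u i) (flipWord a u j)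
  rcases le_total ‖A‖ ‖B‖ with hAB | hBA
  · obtain ⟨m, hm⟩ := exists_alternate_norm_sq_le hij hl hc h₀ h₁ hκ hκ1 hθ hAB
    refine ⟨_, reduced_alternate hij hi m, ?_, fun k hki hkj =>
      flipWord_alternate_of_ne hki hkj (m + 1), hm⟩
    rw [length_alternate]
    omega
  · -- In the opposite direction the sequence has the coefficients `B * l⁻¹` and `A * l`.
    have hle : ‖B * l⁻¹‖ ≤ ‖A * l‖ := by
      rw [norm_mul, norm_mul, norm_inv]
      exact (mul_le_of_le_one_right (norm_nonneg _) (inv_le_one_of_one_le₀ hl.le)).trans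
        (hBA.trans (le_mul_of_one_le_right (norm_nonneg _) hl.le))
    have h₁' : binet l (B * l⁻¹) (A * l) 0 = flipWord a u j := by
      rw [← h₁]; simp only [binet]; ring
    have h₀' : binet l (B * l⁻¹) (A * l) 1 = flipWord a u i := by
      rw [← h₀]; simp only [binet]; field_simp; ring
    rw [prodErasePair_comm] at hc hκ
    obtain ⟨m, hm⟩ := exists_alternate_norm_sq_le hij.symm hl hc h₁' h₀' hκ hκ1 hθ hle
    refine ⟨_, reduced_alternate hij.symm hj m, ?_, fun k hki hkj =>
      flipWord_alternate_of_ne hkj hki (m + 1), ?_⟩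
    · rw [length_alternate]
      omega
    · rw [add_comm (‖_‖ ^ 2), add_comm (flipWord a u i ^ 2), prodErasePair_comm, mul_right_comm]
      exact hm

theorem exists_longer_energy_le (hn : 3 ≤ n) (hr : 0 < r) (hr1 : 10 * r ≤ 1) (hij : i ≠ j)
    (hi : Reduced (i :: u)) (hj : Reduced (j :: u))
    (hcut : prodErasePair (flipWord a u) i j ∉ cutInterval) (h : energy (flipWord a u) ≤ r ^ 2) :
    ∃ w, Reduced w ∧ u.length < w.length ∧ energy (flipWord a w) ≤ energy (flipWord a u) -
      (‖flipWord a u i‖ ^ 2 + ‖flipWord a u j‖ ^ 2) +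
      ‖flipWord a u i ^ 2 + flipWord a u j ^ 2‖ + 12 * r ^ 3 := by
  have hpair : ‖prodErasePair (flipWord a u) i j‖ ≤ r := by
    refine (norm_prod_le_pow hr.le (by linarith) (norm_le_of_energy_le hr.le h) ?_).trans_eq
      (pow_one r)
    rw [Finset.card_compl, Finset.card_pair hij, Fintype.card_fin]
    omega
  obtain ⟨w, hw, hlen, hfix, hle⟩ :=
    exists_longer_norm_sq_le hij hi hj hcut hpair (by linarith) (pow_pos hr 3)
  refine ⟨w, hw, hlen, ?_⟩
  have henergy := energy_sub_energy hij hfix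
  have hsq := (norm_sq_add_norm_sq_le_energy hij (flipWord a u)).trans h
  set c := prodErasePair (flipWord a u) i j
  set x := flipWord a u i
  set y := flipWord a u j
  have hmixed : ‖c * x * y‖ ≤ r ^ 3 / 2 := by
    rw [norm_mul, norm_mul, mul_assoc]
    calc ‖c‖ * (‖x‖ * ‖y‖) ≤ r * (r ^ 2 / 2) := by
          gcongr
          nlinarith [sq_nonneg (‖x‖ - ‖y‖)]
      _ = r ^ 3 / 2 := by ring
  have hsum : ‖x ^ 2 + y ^ 2‖ ≤ r ^ 2 := by
    refine (norm_add_le _ _).trans ?_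
    rwa [norm_pow, norm_pow]
  have hform : ‖x ^ 2 + y ^ 2 - c * x * y‖ ≤ ‖x ^ 2 + y ^ 2‖ + r ^ 3 / 2 :=
    (norm_sub_le _ _).trans (by gcongr)
  have herror : r * ‖x ^ 2 + y ^ 2 - c * x * y‖ ≤ r * (r ^ 2 + r ^ 3 / 2) := by
    gcongr
    linarith
  have hr4 : 10 * r * r ^ 3 ≤ 1 * r ^ 3 := by gcongr
  linarith

/-- Since the Hurwitz polynomial is small, so is the sum of the squares of the coordinates; hence
the largest square is partly cancelled by another one. -/
theorem exists_norm_sq_add_sq_le (hn : 3 ≤ n) (hr : 0 < r) (hrn : 1000 * (n : ℝ) ^ 2 * r ≤ 1)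
    (hH : ‖hurwitz x‖ ≤ r ^ 3) (h : energy x ≤ r ^ 2) (h' : r ^ 2 / 2 < energy x) :
    ∃ i j, i ≠ j ∧
      ‖x i ^ 2 + x j ^ 2‖ ≤ ‖x i‖ ^ 2 + ‖x j‖ ^ 2 - r ^ 2 / (8 * (n : ℝ) ^ 2) := by
  have hn' : (3 : ℝ) ≤ n := mod_cast hn
  have hr1 : 8 * (n * r) ≤ 1 := by nlinarith
  have : Nonempty (Fin n) := ⟨⟨0, by omega⟩⟩
  obtain ⟨p, hp⟩ := Finite.exists_max fun k => ‖x k ^ 2‖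
  have hmax : r ^ 2 / (2 * n) < ‖x p ^ 2‖ := by
    have hle : energy x ≤ n * ‖x p ^ 2‖ := by
      simpa [energy] using Finset.sum_le_card_nsmul Finset.univ _ _ fun k _ => hp k
    rw [div_lt_iff₀ (by positivity)]
    linarith
  have hprod : ‖∏ k, x k‖ ≤ r ^ 3 :=
    norm_prod_le_pow hr.le (by nlinarith) (norm_le_of_energy_le hr.le h) (by simpa)
  have hsum : ‖∑ k, x k ^ 2‖ ≤ ‖x p ^ 2‖ / 2 := by
    have hr3 : 2 * r ^ 3 ≤ r ^ 2 / (2 * n) / 2 := by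
      rw [div_div, le_div_iff₀ (by positivity)]
      nlinarith [sq_pos_of_pos hr]
    have := norm_add_le (hurwitz x) (∏ k, x k)
    rw [hurwitz, sub_add_cancel] at this
    rw [hurwitz] at hH
    linarith
  obtain ⟨q, -, hqp, hle⟩ := exists_norm_add_le_of_norm_sum_le (z := fun k => x k ^ 2)
    (Finset.mem_univ p) (norm_pos_iff.mp (lt_trans (by positivity) hmax)) (fun k _ => hp k) hsum
  rw [Finset.card_univ, Fintype.card_fin] at hle
  refine ⟨q, p, hqp, hle.trans ?_⟩
  rw [← norm_pow, ← norm_pow]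
  refine sub_le_sub_left ?_ _
  calc r ^ 2 / (8 * (n : ℝ) ^ 2) = r ^ 2 / (2 * n) / (4 * n) := by field_simp; ring
    _ ≤ ‖x p ^ 2‖ / (4 * n) := by gcongr

theorem exists_reduced_cons_cons {α : Type*} {i j k : α} {u : List α} (hki : k ≠ i) (hkj : k ≠ j)
    (hu : Reduced u) : ∃ v, (v = u ∨ v = k :: u) ∧ Reduced (i :: v) ∧ Reduced (j :: v) := by
  by_cases h : Reduced (i :: u) ∧ Reduced (j :: u)
  · exact ⟨u, Or.inl rfl, h⟩
  · have hk : Reduced (k :: u) := by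
      cases u with
      | nil => exact List.isChain_singleton k
      | cons p t =>
        refine List.isChain_cons_cons.mpr ⟨?_, hu⟩
        rintro rfl
        exact h ⟨List.isChain_cons_cons.mpr ⟨hki.symm, hu⟩,
          List.isChain_cons_cons.mpr ⟨hkj.symm, hu⟩⟩
    exact ⟨k :: u, Or.inr rfl, List.isChain_cons_cons.mpr ⟨hki.symm, hk⟩,
      List.isChain_cons_cons.mpr ⟨hkj.symm, hk⟩⟩

theorem exists_longer_of_energy_le (hn : 3 ≤ n) (hr : 0 < r) (hrn : 1000 * (n : ℝ) ^ 2 * r ≤ 1)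
    (hcut : ∀ γ : AltGeodesic n, extHurwitz a γ ∉ cutInterval) (hH : ‖hurwitz a‖ ≤ r ^ 3)
    (hu : Reduced u) (h : energy (flipWord a u) ≤ r ^ 2) :
    ∃ w, Reduced w ∧ u.length < w.length ∧ energy (flipWord a w) ≤ r ^ 2 := by
  have hn' : (3 : ℝ) ≤ n := mod_cast hn
  have hr1 : 100 * r ≤ 1 := by nlinarith
  have hr3 : 100 * r ^ 3 ≤ r ^ 2 := by nlinarith [sq_pos_of_pos hr]
  have hflip (k : Fin n) : energy (flipWord a (k :: u)) ≤ energy (flipWord a u) + 3 * r ^ 3 :=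
    energy_flipMap_le hn hr.le (by linarith) (norm_le_of_energy_le hr.le h) k
  rcases le_or_gt (energy (flipWord a u)) (r ^ 2 / 2) with h' | h'
  · obtain ⟨k, hk⟩ : ∃ k, Reduced (k :: u) := by
      have := Fin.nontrivial_iff_two_le.mpr (by omega : 2 ≤ n)
      cases u with
      | nil => exact ⟨⟨0, by omega⟩, List.isChain_singleton _⟩
      | cons p t => exact (exists_ne p).imp fun k hk => List.isChain_cons_cons.mpr ⟨hk, hu⟩
    exact ⟨k :: u, hk, by simp, by linarith [hflip k]⟩
  · obtain ⟨i, j, hij, hcancel⟩ :=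
      exists_norm_sq_add_sq_le hn hr hrn ((hurwitz_flipWord a u).symm ▸ hH) h h'
    obtain ⟨k, hki, hkj⟩ := Fin.exists_ne_and_ne_of_two_lt i j hn
    obtain ⟨v, hv, hvi, hvj⟩ := exists_reduced_cons_cons hki hkj hu
    have hlen : u.length ≤ v.length := by rcases hv with rfl | rfl <;> simp
    have hvE : energy (flipWord a v) ≤ energy (flipWord a u) + 3 * r ^ 3 := by
      rcases hv with rfl | rfl
      exacts [le_add_of_nonneg_right (by positivity), hflip k]
    have hfix {p : Fin n} (hp : k ≠ p) : flipWord a v p = flipWord a u p := by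
      rcases hv with rfl | rfl
      exacts [rfl, flipMap_of_ne _ hp.symm]
    obtain ⟨w, hw, hvw, hle⟩ := exists_longer_energy_le (r := 2 * r) hn (by linarith) (by linarith)
      hij hvi hvj (extHurwitz_geodesic a v hij ▸ hcut _) (by nlinarith)
    rw [hfix hki, hfix hkj] at hle
    have hgain : 125 * r ^ 3 ≤ r ^ 2 / (8 * (n : ℝ) ^ 2) := by
      rw [le_div_iff₀ (by positivity)]
      nlinarith [sq_pos_of_pos hr]
    exact ⟨w, hw, hlen.trans_lt hvw, by nlinarith [pow_pos hr 3]⟩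

theorem continuous_hurwitz : Continuous (hurwitz (n := n)) := by
  unfold hurwitz
  fun_prop

theorem continuous_energy : Continuous (energy (n := n)) := by
  unfold energy
  fun_prop

theorem zero_notMem_closure_bowditchDomain (hn : 3 ≤ n) :
    (0 : Fin n → ℂ) ∉ closure (bowditchDomain n) := by
  have : (0 : ℝ) < n := mod_cast (by omega : 0 < n)
  obtain ⟨r, hr, hrn⟩ : ∃ r : ℝ, 0 < r ∧ 1000 * (n : ℝ) ^ 2 * r ≤ 1 :=
    ⟨1 / (1000 * (n : ℝ) ^ 2), by positivity, by rw [mul_one_div_cancel (by positivity)]⟩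
  have hH : ∀ᶠ a : Fin n → ℂ in nhds 0, ‖hurwitz a‖ < r ^ 3 :=
    continuous_hurwitz.norm.continuousAt.eventually_lt_const (by
      simpa [hurwitz, show n ≠ 0 by omega] using pow_pos hr 3)
  have hE : ∀ᶠ a : Fin n → ℂ in nhds 0, energy a < r ^ 2 :=
    continuous_energy.continuousAt.eventually_lt_const (by simpa [energy] using pow_pos hr 2)
  intro hcl
  obtain ⟨a, ⟨haH, haE⟩, ha⟩ := mem_closure_iff_nhds.mp hcl _ (hH.and hE)
  have hfin : {w : List (Fin n) | Reduced w ∧ energy (flipWord a w) ≤ r ^ 2}.Finite := by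
    refine ((finite_setOf_norm_vecHurwitz_le hn (Set.singleton_subset_iff.mpr ha)
      isCompact_singleton r).image normalForm).subset fun w hw =>
      ⟨eval w, ⟨a, rfl, ?_⟩, normalForm_eval hw.1⟩
    rw [vecHurwitz_eval]
    exact (pi_norm_le_iff_of_nonneg hr.le).mpr (norm_le_of_energy_le hr.le hw.2)
  obtain ⟨u, ⟨hu, huE⟩, hmax⟩ := Set.exists_max_image _ List.length hfin
    ⟨[], List.isChain_nil, haE.le⟩
  obtain ⟨w, hw, hlen, hwE⟩ := exists_longer_of_energy_le hn hr hrn ha.1 haH.le hu huE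
  exact hlen.not_ge (hmax w ⟨hw, hwE⟩)

end Energy

end MarkoffHurwitz

theorem theorem1p4 (n : ℕ) (hn : 3 ≤ n) :
    (MarkoffHurwitz.bowditchDomain n).Nonempty ∧
    IsOpen (MarkoffHurwitz.bowditchDomain n) ∧
    (∀ g : MarkoffHurwitz.Gam n,
      (fun x : Fin n → ℂ => g • x) '' MarkoffHurwitz.bowditchDomain n =
        MarkoffHurwitz.bowditchDomain n) ∧
    (∀ C : Set (Fin n → ℂ), C ⊆ MarkoffHurwitz.bowditchDomain n → IsCompact C →
      {g : MarkoffHurwitz.Gam n |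
        ((fun x : Fin n → ℂ => g • x) '' C ∩ C).Nonempty}.Finite) ∧
    (0 : Fin n → ℂ) ∉ closure (MarkoffHurwitz.bowditchDomain n) :=
  ⟨MarkoffHurwitz.bowditchDomain_nonempty hn, MarkoffHurwitz.isOpen_bowditchDomain hn,
    MarkoffHurwitz.image_smul_bowditchDomain,
    fun _ hC hcomp => MarkoffHurwitz.finite_setOf_inter_nonempty hn hC hcomp,
    MarkoffHurwitz.zero_notMem_closure_bowditchDomain hn⟩
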